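/- **Model.** The input is a simple undirected graph $G=(V,E)$ with $n=|V|\ge 1$ vertices, $m=|E|$ edges and no isolated vertices; its average degree is $d=2m/n$. The number $n$ is known. The vertices carry distinct natural-number identifiers unknown to the algorithm, and $G$ is accessed only through the following queries, whose random answers are all independent: $\mathbf{RandVert}$ (a uniformly random vertex), $\mathbf{RandNbr}(x)$ (a uniformly random neighbor of $x$), $\mathbf{Degree}(x)$ (the degree of $x$), $\mathbf{RandEdge}$ (a uniformly random edge), and, in addition, either $\mathbf{Pair}(x,y)$ (whether $\{x,y\}\in E$) or $\mathbf{Additive}(S)$ for a finite set $S$ of vertices (the number of edges with both endpoints in $S$). The query $\mathbf{Additive}(S)$ costs $|S|$, every other query costs $1$, and internal randomness is free. **Statement.** (Pair) There are constants $C,k$ and a randomized algorithm EstimateAverageDegree, with inputs $n$ and $\varepsilon\in(0,1)$ and using $\mathbf{RandVert}$, $\mathbf{RandNbr}$, $\mathbf{RandEdge}$, $\mathbf{Degree}$ and $\mathbf{Pair}$, such that for every $\varepsilon\in(0,1)$ and every $G$ as above, with probability $>0.99$ its output $\widehat d$ satisfies $|\widehat d-d|\le \varepsilon d$ and the total cost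 of its queries is at most $C\,\varepsilon^{-2}(\log n)^k\,(n/d)^{1/3}$ (that is, $\widetilde O(\varepsilon^{-2}(n/d)^{1/3})$). (Additive) The same holds with $\mathbf{Additive}$ in place of $\mathbf{Pair}$ and with the bound $C\,\varepsilon^{-2}(\log n)^k\,(n/d)^{1/4}$ (that is, $\widetilde O(\varepsilon^{-2}(n/d)^{1/4})$). -/

import Mathlib

open scoped ENNReal

namespace SublinearGraph

/-- The structural oracle that is available on top of random vertices, random neighbors,
degrees and random edges: either pair queries or additive queries. -/
inductive Access where
  | pair
  | additive

/-- The queries an algorithm may ask. Vertices are referred to by their identifiers, which are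
natural numbers. Pair queries exist only under `Access.pair`, additive queries only under
`Access.additive`. -/
inductive Query : Access → Type where
  | randVert {M : Access} : Query M
  | randNbr {M : Access} (x : ℕ) : Query M
  | degree {M : Access} (x : ℕ) : Query M
  | randEdge {M : Access} : Query M
  | pair (x y : ℕ) : Query Access.pair
  | additive (S : Finset ℕ) : Query Access.additive

/-- The type of the answer to a query. -/
def Query.Answer {M : Access} : Query M → Type
  | .randVert => ℕ
  | .randNbr _ => ℕ
  | .degree _ => ℕ
  | .randEdge => Sym2 ℕ
  | .pair _ _ => Bool
  | .additive _ => ℕ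

/-- Every query has unit cost, except that `additive S` costs `|S|`. -/
def Query.cost {M : Access} : Query M → ℕ
  | .additive S => S.card
  | _ => 1

/-- A randomized adaptive query algorithm (a randomized decision tree) with output in `α`:
it stops with an output, or draws internal randomness (free of charge), or asks a query and
continues depending on the answer. -/
inductive Algorithm (M : Access) (α : Type) : Type where
  | output (a : α) : Algorithm M α
  | sample (μ : PMF ℕ) (next : ℕ → Algorithm M α) : Algorithm M α
  | ask (q : Query M) (next : q.Answer → Algorithm M α) : Algorithm M α

section Semantics

/-- The uniform distribution on `s`; on the empty set, the point mass at the default `b`. -/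
noncomputable def uniformOr {β : Type} (s : Finset β) (b : β) : PMF β :=
  if h : s.Nonempty then PMF.uniformOfFinset s h else PMF.pure b

variable {V : Type*} [Fintype V] [DecidableEq V] (G : SimpleGraph V) [DecidableRel G.Adj]
  (ident : V ↪ ℕ)

/-- The distribution of the answer to a query on the graph `G` whose vertex `v` has identifier
`ident v`. A number `x` that is not the identifier of a vertex gets uninformative answers:
it is treated like an isolated vertex, and `randNbr x` returns `x` itself. -/
noncomputable def answer {M : Access} : (q : Query M) → PMF q.Answer
  | .randVert => uniformOr (Finset.univ.map ident) (0 : ℕ)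
  | .randNbr x =>
      match Function.partialInv ident x with
      | some v => uniformOr ((G.neighborFinset v).map ident) x
      | none => PMF.pure x
  | .degree x =>
      match Function.partialInv ident x with
      | some v => PMF.pure (G.degree v)
      | none => PMF.pure (0 : ℕ)
  | .randEdge => uniformOr (G.edgeFinset.map ident.sym2Map) s(0, 0)
  | .pair x y => PMF.pure (decide (∃ u v : V, ident u = x ∧ ident v = y ∧ G.Adj u v))
  | .additive S => PMF.pure ((G.edgeFinset.filter fun e => ∀ v ∈ e, ident v ∈ S).card : ℕ)

/-- The joint distribution of the output of an algorithm and of the total cost of the queries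
it asks, on the graph `G`. All answers are drawn with fresh independent randomness. -/
noncomputable def run {M : Access} {α : Type} : Algorithm M α → PMF (α × ℕ)
  | .output a => PMF.pure (a, 0)
  | .sample μ next => μ.bind fun i => run (next i)
  | .ask q next => (answer G ident q).bind fun a =>
      (run (next a)).map fun o => (o.1, q.cost + o.2)

/-- The average degree `2 m / n`. -/
noncomputable def avgDegree : ℝ :=
  2 * (G.edgeFinset.card : ℝ) / (Fintype.card V : ℝ)

end Semantics

end SublinearGraph

/-!
Fix a guess `g = n / 2 ^ i` of the average degree `d`, and call an edge heavy if both its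
endpoints have degree above a threshold `t`. The fraction `h` of heavy edges is estimated from
random edges. The other edges contribute `(1 - h) * d` to the average degree, which is estimated
from random vertices of degree at most `t` and one random neighbor of each, with `t / g` samples.

If most edges are heavy, then `(1 - h) * d` is too small to be of use. Instead, weighting the
endpoints of random edges by the inverses of their degrees makes all vertices of degree above `t`
equally likely, and the expected weight of an adjacent pair of two independent endpoints is
`h / D`, where `D` is the sum of the degrees, so that `D` is the quotient of two estimates. The
weights are below `1 / t`, so that about `D / t ^ 2` pairs suffice. With `t = r * g` and
`d ≤ g = n / 2 ^ i` this is at most `2 ^ i / r ^ 2`, which is `r` for `r = 2 ^ (i / 3)`. Additive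
queries look at all `r ^ 2` pairs between two samples of size `r` at once, so that
`r = 2 ^ (i / 4)` is enough; they only see sets, so that the weights are rounded to integers and
treated one binary digit at a time.

The guess is halved until the resulting estimate is consistent with it.
-/

namespace SublinearGraph

open scoped NNReal

theorem coe_list_sum (l : List ℝ≥0) :
    ((l.sum : ℝ≥0) : ℝ≥0∞) = (l.map fun x : ℝ≥0 => (x : ℝ≥0∞)).sum :=
  map_list_sum ENNReal.ofNNRealHom l

section Expect

/-- The expectation of a nonnegative function. -/
noncomputable def expect {α : Type*} (p : PMF α) (φ : α → ℝ≥0∞) : ℝ≥0∞ := ∑' x, p x * φ x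

variable {α β : Type*}

theorem expect_pure (a : α) (φ : α → ℝ≥0∞) : expect (PMF.pure a) φ = φ a := by
  rw [expect, tsum_eq_single a fun b hb => by simp [PMF.pure_apply, hb]]
  simp

theorem expect_bind (p : PMF α) (q : α → PMF β) (φ : β → ℝ≥0∞) :
    expect (p.bind q) φ = expect p fun x => expect (q x) φ := by
  simp only [expect, PMF.bind_apply, ← ENNReal.tsum_mul_right, ← ENNReal.tsum_mul_left]
  rw [ENNReal.tsum_comm]
  simp only [mul_assoc]

theorem expect_map (p : PMF α) (f : α → β) (φ : β → ℝ≥0∞) :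
    expect (p.map f) φ = expect p fun x => φ (f x) := by
  simp only [← PMF.bind_pure_comp, expect_bind, Function.comp_apply, expect_pure]

theorem expect_mono_of_support {p : PMF α} {φ ψ : α → ℝ≥0∞}
    (h : ∀ x ∈ p.support, φ x ≤ ψ x) : expect p φ ≤ expect p ψ := by
  refine ENNReal.tsum_le_tsum fun x => ?_
  by_cases hx : p x = 0
  · simp [hx]
  · exact mul_le_mul_right (h x ((PMF.mem_support_iff p x).2 hx)) _

theorem expect_const (p : PMF α) (c : ℝ≥0∞) : expect p (fun _ => c) = c := by
  rw [expect, ENNReal.tsum_mul_right, p.tsum_coe, one_mul]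

theorem expect_add (p : PMF α) (φ ψ : α → ℝ≥0∞) :
    expect p (fun x => φ x + ψ x) = expect p φ + expect p ψ := by
  simp only [expect, mul_add, ENNReal.tsum_add]

theorem expect_const_mul (p : PMF α) (c : ℝ≥0∞) (φ : α → ℝ≥0∞) :
    expect p (fun x => c * φ x) = c * expect p φ := by
  simp only [expect, mul_left_comm _ c, ENNReal.tsum_mul_left]

theorem expect_comm (p : PMF α) (q : PMF β) (φ : α → β → ℝ≥0∞) :
    (expect p fun x => expect q (φ x)) = expect q fun y => expect p fun x => φ x y := by
  simp only [expect, ← ENNReal.tsum_mul_left]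
  rw [ENNReal.tsum_comm]
  exact tsum_congr fun y => tsum_congr fun x => mul_left_comm _ _ _

theorem expect_uniformOr {γ : Type} {s : Finset γ} (hs : s.Nonempty) (b : γ) (φ : γ → ℝ≥0∞) :
    expect (uniformOr s b) φ = (s.card : ℝ≥0∞)⁻¹ * ∑ x ∈ s, φ x := by
  classical
  rw [expect, uniformOr, dif_pos hs, tsum_eq_sum (s := s) fun x hx => by
    rw [PMF.uniformOfFinset_apply_of_notMem hs hx, zero_mul], Finset.mul_sum]
  exact Finset.sum_congr rfl fun x hx => by rw [PMF.uniformOfFinset_apply_of_mem hs hx]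

theorem mul_toOuterMeasure_le_expect (p : PMF α) {S : Set α} {c : ℝ≥0∞} {φ : α → ℝ≥0∞}
    (h : ∀ x ∈ p.support, x ∈ S → c ≤ φ x) : c * p.toOuterMeasure S ≤ expect p φ := by
  rw [PMF.toOuterMeasure_apply, ← ENNReal.tsum_mul_left]
  refine ENNReal.tsum_le_tsum fun x => ?_
  by_cases hx : x ∈ S ∧ x ∈ p.support
  · rw [Set.indicator_of_mem hx.1, mul_comm]
    exact mul_le_mul_right (h x hx.2 hx.1) _
  · have hzero : S.indicator p x = 0 := by
      simpa [Set.indicator_apply_eq_zero, PMF.mem_support_iff] using hx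
    simp [hzero]

theorem toOuterMeasure_compl_add (p : PMF α) (S : Set α) :
    p.toOuterMeasure Sᶜ + p.toOuterMeasure S = 1 := by
  simp only [PMF.toOuterMeasure_apply]
  rw [← ENNReal.tsum_add, ← p.tsum_coe]
  exact tsum_congr fun x => congrFun (Set.indicator_compl_add_self S p) x

theorem toOuterMeasure_bind_le {p : PMF α} {f : α → PMF β} {S : Set α} {T : Set β}
    {δ δ' : ℝ≥0∞} (hS : p.toOuterMeasure Sᶜ ≤ δ)
    (hT : ∀ a ∈ S, (f a).toOuterMeasure T ≤ δ') :
    (p.bind f).toOuterMeasure T ≤ δ + δ' := by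
  have hbound : ∀ a, (f a).toOuterMeasure T ≤ Sᶜ.indicator 1 a + δ' := fun a => by
    by_cases ha : a ∈ S
    · exact (hT a ha).trans le_add_self
    · rw [Set.indicator_of_mem (Set.mem_compl ha), Pi.one_apply]
      exact ((toOuterMeasure_compl_add (f a) T).symm ▸ le_add_self).trans le_self_add
  calc (p.bind f).toOuterMeasure T = expect p fun a => (f a).toOuterMeasure T :=
        PMF.toOuterMeasure_bind_apply p f T
    _ ≤ expect p fun a => Sᶜ.indicator 1 a + δ' := expect_mono_of_support fun a _ => hbound a
    _ = p.toOuterMeasure Sᶜ + δ' := by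
        rw [expect_add, expect_const, expect, PMF.toOuterMeasure_apply]
        congr 1
        refine tsum_congr fun a => ?_
        by_cases ha : a ∈ S <;> simp [ha]
    _ ≤ δ + δ' := by gcongr

end Expect

namespace Algorithm

section Programs

variable {M : Access} {α β : Type}

/-- Sequential composition. -/
protected def bind : Algorithm M α → (α → Algorithm M β) → Algorithm M β
  | .output a, f => f a
  | .sample μ next, f => .sample μ fun i => (next i).bind f
  | .ask q next, f => .ask q fun a => (next a).bind f

instance : Monad (Algorithm M) where
  pure := .output
  bind := .bind

/-- The algorithm that asks a single query and returns the answer. -/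
def query (q : Query M) : Algorithm M q.Answer := .ask q .output

/-- The algorithm that draws a number from `μ`, free of charge. -/
def draw (μ : PMF ℕ) : Algorithm M ℕ := .sample μ .output

/-- The list of the outputs of `r` independent executions. -/
def replicate (A : Algorithm M α) : ℕ → Algorithm M (List α)
  | 0 => pure []
  | r + 1 => do
    let a ← A
    let l ← A.replicate r
    pure (a :: l)

/-- The empirical mean of `r` independent executions; it is `0` for `r = 0`. -/
noncomputable def average (A : Algorithm M ℝ≥0) (r : ℕ) : Algorithm M ℝ≥0 := do
  let l ← A.replicate r
  pure (l.sum / r)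

/-- On every execution path that internal randomness can produce, whatever the answers to the
queries, the cost is at most `c` and the output satisfies `P`. -/
def Within : Algorithm M α → ℕ → (α → Prop) → Prop
  | .output a, _, P => P a
  | .sample μ next, c, P => ∀ i ∈ μ.support, (next i).Within c P
  | .ask q next, c, P => q.cost ≤ c ∧ ∀ a, (next a).Within (c - q.cost) P

theorem Within.pure {a : α} {c : ℕ} {P : α → Prop} (h : P a) :
    (Pure.pure a : Algorithm M α).Within c P := h

theorem Within.query (q : Query M) : (query q).Within q.cost fun _ => True :=
  ⟨le_rfl, fun _ => trivial⟩

theorem Within.draw (μ : PMF ℕ) : (draw μ : Algorithm M ℕ).Within 0 (· ∈ μ.support) :=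
  fun _ hi => hi

theorem Within.mono {A : Algorithm M α} {c c' : ℕ} {P P' : α → Prop} (h : A.Within c P)
    (hc : c ≤ c') (hP : ∀ a, P a → P' a) : A.Within c' P' := by
  induction A generalizing c c' with
  | output a => exact hP a h
  | sample μ next ih => exact fun i hi => ih i (h i hi) hc
  | ask q next ih => exact ⟨h.1.trans hc, fun a => ih a (h.2 a) (by omega)⟩

theorem Within.bind {A : Algorithm M α} {f : α → Algorithm M β} {c c' : ℕ} {P : α → Prop}
    {Q : β → Prop} (h : A.Within c P) (hf : ∀ a, P a → (f a).Within c' Q) :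
    (A >>= f).Within (c + c') Q := by
  induction A generalizing c with
  | output a => exact (hf a h).mono (by omega) fun _ => id
  | sample μ next ih => exact fun i hi => ih i (h i hi)
  | ask q next ih =>
    have := h.1
    exact ⟨by omega, fun a => (ih a (h.2 a)).mono (by omega) fun _ => id⟩

theorem Within.replicate {A : Algorithm M α} {c : ℕ} {P : α → Prop} (h : A.Within c P) (r : ℕ) :
    (A.replicate r).Within (r * c) fun l => l.length = r ∧ ∀ a ∈ l, P a := by
  induction r with
  | zero => exact ⟨rfl, by simp⟩
  | succ r ih =>
    refine (h.bind fun a ha => ih.bind (c' := 0)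
      (Q := fun l : List α => l.length = r + 1 ∧ ∀ b ∈ l, P b) fun l hl => .pure ?_).mono
      (by rw [add_zero, Nat.succ_mul, add_comm]) fun _ => id
    simpa using ⟨hl.1, ha, hl.2⟩

theorem Within.average {A : Algorithm M ℝ≥0} {c : ℕ} {P : ℝ≥0 → Prop} (h : A.Within c P)
    (r : ℕ) : (A.average r).Within (r * c) fun _ => True :=
  (h.replicate r).bind (c' := 0) fun _ _ => .pure trivial

end Programs

section Semantics

variable {M : Access} {α β : Type} {V : Type*} [Fintype V] [DecidableEq V] (G : SimpleGraph V)
  [DecidableRel G.Adj] (ident : V ↪ ℕ)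

theorem run_bind (A : Algorithm M α) (f : α → Algorithm M β) :
    run G ident (A >>= f) = (run G ident A).bind fun o =>
      (run G ident (f o.1)).map fun o' => (o'.1, o.2 + o'.2) := by
  induction A with
  | output a =>
    simp only [bind, Algorithm.bind, run, PMF.pure_bind, zero_add]
    exact (PMF.map_id _).symm
  | sample μ next ih =>
    simp only [bind, Algorithm.bind, run, PMF.bind_bind] at ih ⊢
    simp only [ih]
  | ask q next ih =>
    simp only [bind, Algorithm.bind, run, PMF.bind_bind, PMF.bind_map] at ih ⊢
    simp only [ih, PMF.map_bind, PMF.map_comp, Function.comp_def, add_assoc]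

variable {G ident} in
theorem Within.of_mem_support {A : Algorithm M α} {c : ℕ} {P : α → Prop} (h : A.Within c P)
    {o : α × ℕ} (ho : o ∈ (run G ident A).support) : P o.1 ∧ o.2 ≤ c := by
  induction A generalizing c o with
  | output a =>
    obtain rfl : o = (a, 0) := by simpa [run] using ho
    exact ⟨h, Nat.zero_le _⟩
  | sample μ next ih =>
    obtain ⟨i, hi, ho⟩ := (PMF.mem_support_bind_iff _ _ _).1 ho
    exact ih i (h i hi) ho
  | ask q next ih =>
    obtain ⟨a, -, ho⟩ := (PMF.mem_support_bind_iff _ _ _).1 ho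
    obtain ⟨o', ho', rfl⟩ := (PMF.mem_support_map_iff _ _ _).1 ho
    have hcost := h.1
    exact ⟨(ih a (h.2 a) ho').1, by have := (ih a (h.2 a) ho').2; simp only; omega⟩

/-- The expectation of a function of the output. -/
noncomputable def mean (A : Algorithm M α) (φ : α → ℝ≥0∞) : ℝ≥0∞ :=
  expect (run G ident A) fun o => φ o.1

theorem mean_pure (a : α) (φ : α → ℝ≥0∞) :
    mean G ident (pure a : Algorithm M α) φ = φ a :=
  expect_pure _ _

theorem mean_bind (A : Algorithm M α) (f : α → Algorithm M β) (φ : β → ℝ≥0∞) :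
    mean G ident (A >>= f) φ = mean G ident A fun a => mean G ident (f a) φ := by
  simp only [mean, run_bind, expect_bind, expect_map]

theorem mean_query (q : Query M) (φ : q.Answer → ℝ≥0∞) :
    mean G ident (query q) φ = expect (answer G ident q) φ := by
  simp only [mean, query, run, PMF.pure_map, expect_bind, expect_pure]

theorem mean_draw (μ : PMF ℕ) (φ : ℕ → ℝ≥0∞) :
    mean G ident (draw μ : Algorithm M ℕ) φ = expect μ φ := by
  simp only [mean, draw, run, expect_bind, expect_pure]

theorem mean_add (A : Algorithm M α) (φ ψ : α → ℝ≥0∞) :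
    mean G ident A (fun x => φ x + ψ x) = mean G ident A φ + mean G ident A ψ :=
  expect_add _ _ _

theorem mean_const (A : Algorithm M α) (c : ℝ≥0∞) : mean G ident A (fun _ => c) = c :=
  expect_const _ _

theorem mean_const_mul (A : Algorithm M α) (c : ℝ≥0∞) (φ : α → ℝ≥0∞) :
    mean G ident A (fun x => c * φ x) = c * mean G ident A φ :=
  expect_const_mul _ _ _

theorem mean_mul_const (A : Algorithm M α) (φ : α → ℝ≥0∞) (c : ℝ≥0∞) :
    mean G ident A (fun x => φ x * c) = mean G ident A φ * c := by
  simp only [mul_comm _ c, mean_const_mul]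

theorem mean_comm (A : Algorithm M α) (B : Algorithm M β) (φ : α → β → ℝ≥0∞) :
    (mean G ident A fun x => mean G ident B (φ x)) =
      mean G ident B fun y => mean G ident A fun x => φ x y :=
  expect_comm (run G ident A) (run G ident B) fun x y => φ x.1 y.1

variable {G ident}

theorem mean_mono {A : Algorithm M α} {φ ψ : α → ℝ≥0∞} (h : ∀ x, φ x ≤ ψ x) :
    mean G ident A φ ≤ mean G ident A ψ :=
  expect_mono_of_support fun x _ => h x.1

theorem Within.mean_mono {A : Algorithm M α} {c : ℕ} {P : α → Prop} (h : A.Within c P)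
    {φ ψ : α → ℝ≥0∞} (hφ : ∀ x, P x → φ x ≤ ψ x) : mean G ident A φ ≤ mean G ident A ψ :=
  expect_mono_of_support fun _ ho => hφ _ (h.of_mem_support ho).1

theorem Within.mean_congr {A : Algorithm M α} {c : ℕ} {P : α → Prop} (h : A.Within c P)
    {φ ψ : α → ℝ≥0∞} (hφ : ∀ x, P x → φ x = ψ x) : mean G ident A φ = mean G ident A ψ :=
  le_antisymm (h.mean_mono fun x hx => (hφ x hx).le) (h.mean_mono fun x hx => (hφ x hx).ge)

variable (G ident) in
theorem mean_replicate_sum (A : Algorithm M α) (φ : α → ℝ≥0∞) (r : ℕ) :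
    mean G ident (A.replicate r) (fun l => (l.map φ).sum) = r * mean G ident A φ := by
  induction r with
  | zero => simp [replicate, mean_pure]
  | succ r ih =>
    simp only [replicate, mean_bind, mean_pure, List.map_cons, List.sum_cons, mean_add,
      mean_const, ih]
    push_cast
    ring

variable (G ident) in
theorem mean_replicate_sum_sq (A : Algorithm M α) (φ : α → ℝ≥0∞) (r : ℕ) :
    mean G ident (A.replicate r) (fun l => (l.map φ).sum ^ 2) + r * mean G ident A φ ^ 2 =
      r * mean G ident A (fun a => φ a ^ 2) + r ^ 2 * mean G ident A φ ^ 2 := by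
  induction r with
  | zero => simp [replicate, mean_pure]
  | succ r ih =>
    have hstep : mean G ident (A.replicate (r + 1)) (fun l => (l.map φ).sum ^ 2) =
        mean G ident A (fun a => φ a ^ 2) + 2 * r * mean G ident A φ ^ 2 +
          mean G ident (A.replicate r) (fun l => (l.map φ).sum ^ 2) := by
      simp only [replicate, mean_bind, mean_pure, List.map_cons, List.sum_cons, add_sq, mean_add,
        mean_const, mean_const_mul, mean_mul_const, mean_replicate_sum]
      ring
    calc _ = (mean G ident (A.replicate r) (fun l => (l.map φ).sum ^ 2) +
          r * mean G ident A φ ^ 2) + (mean G ident A (fun a => φ a ^ 2) +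
          2 * r * mean G ident A φ ^ 2 + mean G ident A φ ^ 2) := by rw [hstep]; push_cast; ring
      _ = _ := by rw [ih]; push_cast; ring

end Semantics

section Succeeds

variable {M : Access} {α β : Type} {V : Type*} [Fintype V] [DecidableEq V] (G : SimpleGraph V)
  [DecidableRel G.Adj] (ident : V ↪ ℕ)

/-- Up to a failure probability of at most `δ`, the output satisfies `P` and the cost is at most
`c`. -/
def Succeeds (A : Algorithm M α) (c : ℕ) (P : α → Prop) (δ : ℝ≥0) : Prop :=
  (run G ident A).toOuterMeasure {o | P o.1 ∧ o.2 ≤ c}ᶜ ≤ δ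

variable {G ident}

theorem Within.succeeds {A : Algorithm M α} {c : ℕ} {P : α → Prop} (h : A.Within c P) :
    Succeeds G ident A c P 0 := by
  refine le_of_eq ((PMF.toOuterMeasure_apply_eq_zero_iff _ _).2 ?_)
  exact Set.disjoint_compl_right_iff_subset.2 fun _ ho => h.of_mem_support ho

theorem Succeeds.mono {A : Algorithm M α} {c c' : ℕ} {P P' : α → Prop} {δ δ' : ℝ≥0}
    (h : Succeeds G ident A c P δ) (hc : c ≤ c') (hP : ∀ a, P a → P' a) (hδ : δ ≤ δ') :
    Succeeds G ident A c' P' δ' :=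
  have hsub : {o : α × ℕ | P' o.1 ∧ o.2 ≤ c'}ᶜ ⊆ {o | P o.1 ∧ o.2 ≤ c}ᶜ :=
    Set.compl_subset_compl.2 fun _ ho => ⟨hP _ ho.1, ho.2.trans hc⟩
  (((run G ident A).toOuterMeasure.mono hsub).trans h).trans (ENNReal.coe_le_coe.2 hδ)

theorem Succeeds.bind {A : Algorithm M α} {f : α → Algorithm M β} {c c' : ℕ} {P : α → Prop}
    {Q : β → Prop} {δ δ' : ℝ≥0} (hA : Succeeds G ident A c P δ)
    (hf : ∀ a, P a → Succeeds G ident (f a) c' Q δ') :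
    Succeeds G ident (A >>= f) (c + c') Q (δ + δ') := by
  rw [Succeeds, run_bind, ENNReal.coe_add]
  refine toOuterMeasure_bind_le hA fun o ho => le_trans ?_ (hf o.1 ho.1)
  rw [PMF.toOuterMeasure_map_apply]
  exact (run G ident _).toOuterMeasure.mono fun o' ho' hgood =>
    ho' ⟨hgood.1, add_le_add ho.2 hgood.2⟩

theorem Succeeds.lt_toOuterMeasure {A : Algorithm M α} {c : ℕ} {P : α → Prop} {δ : ℝ≥0}
    (h : Succeeds G ident A c P δ) {η : ℝ≥0} (hη : δ + η < 1) :
    η < (run G ident A).toOuterMeasure {o | P o.1 ∧ o.2 ≤ c} := by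
  by_contra! hle
  have hsum := toOuterMeasure_compl_add (run G ident A) {o | P o.1 ∧ o.2 ≤ c}
  have := hsum ▸ add_le_add h hle
  exact absurd (by exact_mod_cast this) hη.not_ge

end Succeeds

section IsEstimator

variable {M : Access} {V : Type*} [Fintype V] [DecidableEq V] (G : SimpleGraph V)
  [DecidableRel G.Adj] (ident : V ↪ ℕ)

/-- The output of `A` has mean `μ` and variance at most `v`. -/
structure IsEstimator (A : Algorithm M ℝ≥0) (μ v : ℝ≥0) : Prop where
  mean_eq : mean G ident A (fun x => (x : ℝ≥0∞)) = μ
  mean_sq_le : mean G ident A (fun x => (x : ℝ≥0∞) ^ 2) ≤ μ ^ 2 + v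

variable {G ident} {A : Algorithm M ℝ≥0} {c : ℕ} {μ v : ℝ≥0}

theorem IsEstimator.mono (h : IsEstimator G ident A μ v) {v' : ℝ≥0} (hv : v ≤ v') :
    IsEstimator G ident A μ v' where
  mean_eq := h.mean_eq
  mean_sq_le := h.mean_sq_le.trans (by gcongr)

theorem IsEstimator.of_le {b : ℝ≥0} (hA : A.Within c (· ≤ b))
    (hμ : mean G ident A (fun x => (x : ℝ≥0∞)) = μ) : IsEstimator G ident A μ (b * μ) where
  mean_eq := hμ
  mean_sq_le := calc
    mean G ident A (fun x => (x : ℝ≥0∞) ^ 2) ≤ mean G ident A fun x => b * (x : ℝ≥0∞) :=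
      hA.mean_mono fun x hx => by rw [sq]; gcongr
    _ = ((b * μ : ℝ≥0) : ℝ≥0∞) := by rw [mean_const_mul, hμ, ENNReal.coe_mul]
    _ ≤ μ ^ 2 + (b * μ : ℝ≥0) := le_add_self

theorem IsEstimator.average (h : IsEstimator G ident A μ v) {r : ℕ} (hr : r ≠ 0) :
    IsEstimator G ident (A.average r) μ (v / r) := by
  have hr' : (r : ℝ≥0) ≠ 0 := Nat.cast_ne_zero.2 hr
  have hcoe (l : List ℝ≥0) : ((l.sum / r : ℝ≥0) : ℝ≥0∞) =
      (r⁻¹ : ℝ≥0) * (l.map fun x : ℝ≥0 => (x : ℝ≥0∞)).sum := by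
    rw [div_eq_inv_mul, ENNReal.coe_mul, coe_list_sum]
  have hsum_sq : mean G ident (A.replicate r)
      (fun l => (l.map fun x : ℝ≥0 => (x : ℝ≥0∞)).sum ^ 2) ≤
        ((r * v + r ^ 2 * μ ^ 2 : ℝ≥0) : ℝ≥0∞) := by
    refine (ENNReal.add_le_add_iff_right (a := r * (μ : ℝ≥0∞) ^ 2) (by finiteness)).1 ?_
    calc _ = r * mean G ident A (fun x => (x : ℝ≥0∞) ^ 2) + r ^ 2 * (μ : ℝ≥0∞) ^ 2 := by
          rw [← h.mean_eq, mean_replicate_sum_sq]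
      _ ≤ r * (μ ^ 2 + v) + r ^ 2 * (μ : ℝ≥0∞) ^ 2 := by gcongr; exact h.mean_sq_le
      _ = _ := by push_cast; ring
  constructor
  · simp only [Algorithm.average, mean_bind, mean_pure, hcoe, mean_const_mul, mean_replicate_sum,
      h.mean_eq]
    norm_cast
    field_simp
  · simp only [Algorithm.average, mean_bind, mean_pure, hcoe, mul_pow, mean_const_mul]
    refine (mul_le_mul_right hsum_sq _).trans_eq ?_
    norm_cast
    field_simp
    push_cast
    ring

theorem IsEstimator.succeeds (h : IsEstimator G ident A μ v) (hA : A.Within c fun _ => True)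
    {e : ℝ≥0} (he : e ≠ 0) :
    Succeeds G ident A c (fun x => |(x : ℝ) - μ| ≤ e) (v / e ^ 2) := by
  have hexpand (x : ℝ≥0) : ((nndist x μ : ℝ≥0∞)) ^ 2 + 2 * μ * x = x ^ 2 + μ ^ 2 := by
    norm_cast
    rw [← NNReal.coe_inj]
    push_cast
    rw [NNReal.dist_eq, sq_abs]
    ring
  have hvar : mean G ident A (fun x => (nndist x μ : ℝ≥0∞) ^ 2) ≤ v := by
    refine (ENNReal.add_le_add_iff_right (a := 2 * μ * μ) (by finiteness)).1 ?_
    calc _ = mean G ident A (fun x => (x : ℝ≥0∞) ^ 2) + μ ^ 2 := by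
          nth_rw 2 [← h.mean_eq]
          simp only [← mean_const_mul, ← mean_add, hexpand]
          rw [mean_add, mean_const]
      _ ≤ μ ^ 2 + v + μ ^ 2 := by gcongr; exact h.mean_sq_le
      _ = _ := by ring
  have hmarkov : ((e ^ 2 : ℝ≥0) : ℝ≥0∞) *
      (run G ident A).toOuterMeasure {o | |(o.1 : ℝ) - μ| ≤ e ∧ o.2 ≤ c}ᶜ ≤ v := by
    refine (mul_toOuterMeasure_le_expect _ fun o ho hbad => ?_).trans hvar
    have hfar : ¬ |(o.1 : ℝ) - μ| ≤ e := fun hle => hbad ⟨hle, (hA.of_mem_support ho).2⟩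
    rw [← NNReal.dist_eq, ← coe_nndist, NNReal.coe_le_coe, not_le] at hfar
    beta_reduce
    exact_mod_cast pow_le_pow_left' hfar.le 2
  rw [Succeeds, ENNReal.coe_div (pow_ne_zero 2 he), ENNReal.le_div_iff_mul_le (by simp [he])
    (by simp), mul_comm]
  exact hmarkov

end IsEstimator

end Algorithm

section Graph

variable {V : Type*} [Fintype V] (G : SimpleGraph V) [DecidableRel G.Adj]

theorem sum_neighborFinset_comm {R : Type*} [AddCommMonoid R] (F : V → V → R) :
    ∑ u, ∑ v ∈ G.neighborFinset u, F u v = ∑ u, ∑ v ∈ G.neighborFinset u, F v u :=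
  Finset.sum_comm' fun u v => by simp [G.adj_comm]

theorem sum_neighborFinset_sym2 [Fintype G.edgeSet] {R : Type*} [AddCommMonoid R]
    (F : Sym2 V → R) :
    ∑ u, ∑ v ∈ G.neighborFinset u, F s(u, v) = 2 • ∑ e ∈ G.edgeFinset, F e := by
  classical
  have hdarts : ∑ u, ∑ v ∈ G.neighborFinset u, F s(u, v) = ∑ d : G.Dart, F d.edge := by
    rw [Finset.sum_sigma']
    exact Finset.sum_bij' (fun p hp => ⟨(p.1, p.2), by simpa using hp⟩)
      (fun d _ => ⟨d.fst, d.snd⟩) (by simp) (by simp [SimpleGraph.Dart.adj]) (by simp) (by simp)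
      (by simp [SimpleGraph.Dart.edge])
  rw [hdarts, ← Finset.sum_fiberwise_of_maps_to (s := Finset.univ) (t := G.edgeFinset)
    (g := fun d : G.Dart => d.edge) (by simp [SimpleGraph.Dart.edge_mem]), ← Finset.sum_nsmul]
  refine Finset.sum_congr rfl fun e he => ?_
  rw [Finset.sum_congr rfl (g := fun _ => F e) (by simp +contextual), Finset.sum_const,
    G.dart_edge_fiber_card e (by simpa using he)]

/-- The sum of the degrees, which is twice the number of edges. -/
def totalDegree : ℕ := ∑ v, G.degree v

/-- The number of ordered pairs of adjacent vertices both of which have degree above `t`. -/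
def heavyPairs (t : ℕ) : ℕ :=
  ∑ u, ∑ v ∈ G.neighborFinset u, if t < G.degree u ∧ t < G.degree v then 1 else 0

/-- The number of ordered pairs of adjacent vertices at least one of which has degree at most
`t`. -/
def lightPairs (t : ℕ) : ℕ :=
  ∑ u, ∑ v ∈ G.neighborFinset u, if t < G.degree u ∧ t < G.degree v then 0 else 1

theorem lightPairs_add_heavyPairs (t : ℕ) : lightPairs G t + heavyPairs G t = totalDegree G := by
  simp only [lightPairs, heavyPairs, totalDegree, ← Finset.sum_add_distrib]
  refine Finset.sum_congr rfl fun u _ => ?_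
  rw [← G.card_neighborFinset_eq_degree u, Finset.card_eq_sum_ones]
  exact Finset.sum_congr rfl fun v _ => by split_ifs <;> rfl

theorem heavyPairs_le_totalDegree (t : ℕ) : heavyPairs G t ≤ totalDegree G :=
  (Nat.le_add_left _ _).trans_eq (lightPairs_add_heavyPairs G t)

theorem totalDegree_eq_two_mul_card_edgeFinset [Fintype G.edgeSet] :
    totalDegree G = 2 * G.edgeFinset.card := by
  rw [totalDegree]
  convert G.sum_degrees_eq_twice_card_edges

theorem avgDegree_eq_totalDegree_div : avgDegree G = totalDegree G / Fintype.card V := by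
  rw [avgDegree, totalDegree_eq_two_mul_card_edgeFinset]
  push_cast
  rfl

theorem totalDegree_le_card_sq : totalDegree G ≤ Fintype.card V ^ 2 := by
  refine (Finset.sum_le_card_nsmul _ _ (Fintype.card V) fun v _ =>
    (G.degree_lt_card_verts v).le).trans_eq ?_
  rw [Finset.card_univ, smul_eq_mul, sq]

variable {G}

theorem card_le_totalDegree (hdeg : ∀ v, 1 ≤ G.degree v) : Fintype.card V ≤ totalDegree G := by
  simpa [totalDegree] using Finset.card_nsmul_le_sum Finset.univ (fun v => G.degree v) 1
    fun v _ => hdeg v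

end Graph

namespace Algorithm

section EdgeSampling

variable {M : Access}

/-- The query for a uniformly random vertex. -/
def randVert : Algorithm M ℕ := query .randVert

/-- The query for a uniformly random neighbor of `x`. -/
def randNbr (x : ℕ) : Algorithm M ℕ := query (.randNbr x)

/-- The query for the degree of `x`. -/
def degree (x : ℕ) : Algorithm M ℕ := query (.degree x)

/-- The query for a uniformly random edge. -/
def randEdge : Algorithm M (Sym2 ℕ) := query .randEdge

/-- A uniformly random edge with a uniformly random orientation. -/
noncomputable def randDart : Algorithm M (ℕ × ℕ) := do
  let e ← randEdge
  let b ← draw (uniformOr {0, 1} 0)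
  pure (if b = 0 then (e.inf, e.sup) else (e.sup, e.inf))

/-- A random endpoint of a random edge, together with its degree. -/
noncomputable def endpointDegree : Algorithm M (ℕ × ℕ) := do
  let e ← randDart
  let a ← degree e.1
  pure (e.1, a)

/-- Whether both endpoints of a random edge have degree above `t`. -/
noncomputable def heavyEdge (t : ℕ) : Algorithm M ℝ≥0 := do
  let e ← randDart
  let a ← degree e.1
  let b ← degree e.2
  pure (if t < a ∧ t < b then 1 else 0)

/-- The degree of a random vertex, replaced by zero if it is above `t`, and doubled if it is at
most `t` but that of a random neighbor is above `t`. -/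
noncomputable def lightDegree (t : ℕ) : Algorithm M ℝ≥0 := do
  let u ← randVert
  let a ← degree u
  if a ≤ t then
    let v ← randNbr u
    let b ← degree v
    pure (if t < b then 2 * (a : ℝ≥0) else a)
  else pure 0

theorem within_randVert : (randVert : Algorithm M ℕ).Within 1 fun _ => True := .query _

theorem within_randNbr (x : ℕ) : (randNbr x : Algorithm M ℕ).Within 1 fun _ => True := .query _

theorem within_degree (x : ℕ) : (degree x : Algorithm M ℕ).Within 1 fun _ => True := .query _

theorem within_randEdge : (randEdge : Algorithm M (Sym2 ℕ)).Within 1 fun _ => True := .query _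

theorem within_randDart : (randDart : Algorithm M (ℕ × ℕ)).Within 1 fun _ => True :=
  within_randEdge.bind (c' := 0) fun _ _ =>
    (Within.draw _).bind (c' := 0) fun _ _ => .pure trivial

theorem within_endpointDegree : (endpointDegree : Algorithm M (ℕ × ℕ)).Within 2 fun _ => True :=
  within_randDart.bind (c' := 1) fun _ _ =>
    (within_degree _).bind (c' := 0) fun _ _ => .pure trivial

theorem within_heavyEdge (t : ℕ) : (heavyEdge t : Algorithm M ℝ≥0).Within 3 (· ≤ 1) :=
  within_randDart.bind (c' := 2) fun _ _ =>
    (within_degree _).bind (c' := 1) fun _ _ =>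
      (within_degree _).bind (c' := 0) fun _ _ => .pure (by split_ifs <;> simp)

theorem within_lightDegree (t : ℕ) :
    (lightDegree t : Algorithm M ℝ≥0).Within 4 (· ≤ 2 * (t : ℝ≥0)) := by
  refine within_randVert.bind (c' := 3) fun u _ =>
    (within_degree u).bind (c' := 2) fun a _ => ?_
  split_ifs with ha
  · have hle : (a : ℝ≥0) ≤ t := by exact_mod_cast ha
    exact (within_randNbr u).bind (c' := 1) fun v _ =>
      (within_degree v).bind (c' := 0) fun b _ => .pure <| by
        split_ifs
        · gcongr
        · exact hle.trans (le_mul_of_one_le_left' one_le_two)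
  · exact .pure zero_le

variable {V : Type*} [Fintype V] [DecidableEq V] {G : SimpleGraph V} [DecidableRel G.Adj]
  {ident : V ↪ ℕ}

theorem mean_degree (v : V) (φ : ℕ → ℝ≥0∞) :
    mean G ident (degree (ident v) : Algorithm M ℕ) φ = φ (G.degree v) := by
  have hanswer : answer G ident (.degree (ident v) : Query M) = PMF.pure (G.degree v) := by
    simp only [answer, Function.partialInv_left ident.injective v]
    rfl
  exact (mean_query G ident _ φ).trans (hanswer ▸ expect_pure _ _)

theorem mean_randVert [Nonempty V] (φ : ℕ → ℝ≥0∞) :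
    mean G ident (randVert : Algorithm M ℕ) φ =
      (Fintype.card V : ℝ≥0∞)⁻¹ * ∑ v, φ (ident v) := by
  have hne : (Finset.univ.map ident).Nonempty := by simp
  refine (mean_query G ident (.randVert : Query M) φ).trans ?_
  refine (expect_uniformOr hne (0 : ℕ) φ).trans ?_
  rw [Finset.card_map, Finset.sum_map, Finset.card_univ]

theorem mean_randNbr {v : V} (hv : 0 < G.degree v) (φ : ℕ → ℝ≥0∞) :
    mean G ident (randNbr (ident v) : Algorithm M ℕ) φ =
      (G.degree v : ℝ≥0∞)⁻¹ * ∑ w ∈ G.neighborFinset v, φ (ident w) := by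
  have hanswer : answer G ident (.randNbr (ident v) : Query M) =
      uniformOr ((G.neighborFinset v).map ident) (ident v) := by
    simp only [answer, Function.partialInv_left ident.injective v]
    rfl
  have hne : ((G.neighborFinset v).map ident).Nonempty := by
    rwa [Finset.map_nonempty, ← Finset.card_pos, G.card_neighborFinset_eq_degree]
  refine (mean_query G ident (.randNbr (ident v) : Query M) φ).trans ?_
  rw [hanswer]
  refine (expect_uniformOr hne (ident v) φ).trans ?_
  rw [Finset.card_map, Finset.sum_map, G.card_neighborFinset_eq_degree]

theorem mean_randEdge (hG : 0 < totalDegree G) (φ : Sym2 ℕ → ℝ≥0∞) :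
    mean G ident (randEdge : Algorithm M (Sym2 ℕ)) φ =
      (totalDegree G : ℝ≥0∞)⁻¹ *
        ∑ u, ∑ v ∈ G.neighborFinset u, φ s(ident u, ident v) := by
  have hne : (G.edgeFinset.map ident.sym2Map).Nonempty := by
    rw [Finset.map_nonempty, ← Finset.card_pos]
    have := totalDegree_eq_two_mul_card_edgeFinset G
    omega
  have hsum := sum_neighborFinset_sym2 G fun e => φ (ident.sym2Map e)
  simp only [Function.Embedding.sym2Map_apply, Sym2.map_mk] at hsum
  refine (mean_query G ident (.randEdge : Query M) φ).trans ?_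
  refine (expect_uniformOr hne s(0, 0) φ).trans ?_
  rw [Finset.card_map, Finset.sum_map, totalDegree_eq_two_mul_card_edgeFinset, hsum, nsmul_eq_mul,
    Nat.cast_mul, Nat.cast_two, ENNReal.mul_inv (by simp) (by simp), mul_comm 2⁻¹, mul_assoc,
    ENNReal.inv_mul_cancel_left (by simp) (by simp)]
  rfl

theorem mean_randDart (hG : 0 < totalDegree G) (φ : ℕ × ℕ → ℝ≥0∞) :
    mean G ident (randDart : Algorithm M (ℕ × ℕ)) φ =
      (totalDegree G : ℝ≥0∞)⁻¹ * ∑ u, ∑ v ∈ G.neighborFinset u, φ (ident u, ident v) := by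
  have horient (x y : ℕ) : mean G ident (draw (uniformOr {0, 1} 0) : Algorithm M ℕ)
      (fun b => φ (if b = 0 then (s(x, y).inf, s(x, y).sup) else (s(x, y).sup, s(x, y).inf))) =
        2⁻¹ * (φ (x, y) + φ (y, x)) := by
    rw [mean_draw, expect_uniformOr (by simp)]
    rcases le_total x y with h | h <;> simp [h, add_comm]
  simp only [randDart, mean_bind, mean_pure, mean_randEdge hG, horient, ← Finset.mul_sum,
    Finset.sum_add_distrib]
  rw [sum_neighborFinset_comm G fun u v => φ (ident v, ident u), ← two_mul,
    ENNReal.inv_mul_cancel_left (by simp) (by simp)]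

theorem mean_endpointDegree (hG : 0 < totalDegree G) (φ : ℕ × ℕ → ℝ≥0∞) :
    mean G ident (endpointDegree : Algorithm M (ℕ × ℕ)) φ =
      (totalDegree G : ℝ≥0∞)⁻¹ * ∑ v, G.degree v * φ (ident v, G.degree v) := by
  simp only [endpointDegree, mean_bind, mean_pure, mean_randDart hG, mean_degree,
    Finset.sum_const, G.card_neighborFinset_eq_degree, nsmul_eq_mul]

theorem isEstimator_heavyEdge (hG : 0 < totalDegree G) (t : ℕ) :
    IsEstimator G ident (heavyEdge t : Algorithm M ℝ≥0) (heavyPairs G t / totalDegree G)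
      (heavyPairs G t / totalDegree G) := by
  have hmean : mean G ident (heavyEdge t : Algorithm M ℝ≥0) (fun x => (x : ℝ≥0∞)) =
      ((heavyPairs G t / totalDegree G : ℝ≥0) : ℝ≥0∞) := by
    simp only [heavyEdge, mean_bind, mean_pure, mean_randDart hG, mean_degree, heavyPairs,
      div_eq_inv_mul]
    push_cast [ENNReal.coe_inv (Nat.cast_ne_zero (R := ℝ≥0).2 hG.ne')]
    rfl
  simpa using IsEstimator.of_le (within_heavyEdge t) hmean

theorem mean_lightDegree [Nonempty V] (hdeg : ∀ v, 1 ≤ G.degree v) (t : ℕ) :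
    mean G ident (lightDegree t : Algorithm M ℝ≥0) (fun x => (x : ℝ≥0∞)) =
      ((lightPairs G t / Fintype.card V : ℝ≥0) : ℝ≥0∞) := by
  have hvertex (u : V) : (mean G ident (if G.degree u ≤ t then do
        let v ← randNbr (ident u)
        let b ← degree v
        pure (if t < b then 2 * (G.degree u : ℝ≥0) else G.degree u)
      else pure 0 : Algorithm M ℝ≥0) fun x => (x : ℝ≥0∞)) =
      ∑ v ∈ G.neighborFinset u, ((if t < G.degree u then 0 else 1) +
        if ¬ t < G.degree u ∧ t < G.degree v then 1 else 0) := by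
    have hu : (G.degree u : ℝ≥0∞) ≠ 0 := by simpa using Nat.one_le_iff_ne_zero.1 (hdeg u)
    by_cases hut : t < G.degree u
    · simp [hut, hut.not_ge, mean_pure]
    rw [if_pos (not_lt.1 hut)]
    simp only [mean_bind, mean_pure, mean_degree, mean_randNbr (hdeg u), Finset.mul_sum]
    refine Finset.sum_congr rfl fun v _ => ?_
    by_cases hvt : t < G.degree v <;>
      simp [hut, hvt, mul_left_comm _ (2 : ℝ≥0∞), ENNReal.inv_mul_cancel hu, one_add_one_eq_two]
  have hcount : ∑ u, ∑ v ∈ G.neighborFinset u, ((if t < G.degree u then 0 else 1) +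
      if ¬ t < G.degree u ∧ t < G.degree v then 1 else 0) = (lightPairs G t : ℝ≥0∞) := by
    simp only [Finset.sum_add_distrib]
    rw [sum_neighborFinset_comm G fun u v =>
      if ¬ t < G.degree u ∧ t < G.degree v then (1 : ℝ≥0∞) else 0]
    simp only [← Finset.sum_add_distrib, lightPairs, Nat.cast_sum]
    refine Finset.sum_congr rfl fun u _ => Finset.sum_congr rfl fun v _ => ?_
    by_cases hut : t < G.degree u <;> by_cases hvt : t < G.degree v <;> simp [hut, hvt]
  simp only [lightDegree, mean_bind, mean_randVert, mean_degree, hvertex, hcount]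
  rw [div_eq_inv_mul, ENNReal.coe_mul, ENNReal.coe_inv (by simp)]
  rfl

theorem isEstimator_lightDegree [Nonempty V] (hdeg : ∀ v, 1 ≤ G.degree v) (t : ℕ) :
    IsEstimator G ident (lightDegree t : Algorithm M ℝ≥0) (lightPairs G t / Fintype.card V)
      (2 * t * (lightPairs G t / Fintype.card V)) :=
  .of_le (within_lightDegree t) (mean_lightDegree hdeg t)

end EdgeSampling

end Algorithm

section WeightedList

theorem sum_range_add_div (n : ℕ) {d : ℕ} (hd : 0 < d) :
    ∑ i ∈ Finset.range d, (n + i) / d = n := by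
  induction n with
  | zero =>
    refine Finset.sum_eq_zero fun i hi => ?_
    rw [zero_add, Nat.div_eq_of_lt (Finset.mem_range.1 hi)]
  | succ n ih =>
    have hlast := Finset.sum_range_succ (fun i => (n + i) / d) d
    have hfirst := Finset.sum_range_succ' (fun i => (n + i) / d) d
    rw [Nat.add_div_right n hd] at hlast
    simp only [add_assoc, add_comm 1, add_zero] at hfirst ⊢
    omega

theorem sum_range_add_div_sq_le {n d : ℕ} (hd : 0 < d) (hn : d ≤ n) :
    (∑ i ∈ Finset.range d, ((n + i) / d) ^ 2) * d ≤ 2 * n ^ 2 := calc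
  _ ≤ ∑ i ∈ Finset.range d, 2 * n * ((n + i) / d) := by
    rw [Finset.sum_mul]
    refine Finset.sum_le_sum fun i hi => ?_
    rw [sq, mul_assoc, mul_comm]
    refine Nat.mul_le_mul_right _ ((Nat.div_mul_le_self (n + i) d).trans ?_)
    have := Finset.mem_range.1 hi
    omega
  _ = 2 * n ^ 2 := by rw [← Finset.mul_sum, sum_range_add_div n hd, mul_assoc, sq]

theorem sum_range_two_pow_testBit {B n : ℕ} (h : n < 2 ^ B) :
    ∑ b ∈ Finset.range B, 2 ^ b * (if n.testBit b then 1 else 0) = n := by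
  simp only [mul_ite, mul_one, mul_zero, ← Finset.sum_filter]
  conv_rhs => rw [← Finset.sum_toFinset_bitIndices_two_pow n]
  refine Finset.sum_congr (Finset.ext fun b => ?_) fun _ _ => rfl
  simp only [Finset.mem_filter, Finset.mem_range, List.mem_toFinset, Nat.mem_bitIndices,
    and_iff_right_iff_imp]
  exact fun hb =>
    (Nat.pow_lt_pow_iff_right one_lt_two).1 ((Nat.ge_two_pow_of_testBit hb).trans_lt h)

/-- The total weight of each point in a list of weighted points. -/
def totalWeight (l : List (ℕ × ℕ)) : ℕ → ℕ := (l.map fun p => Pi.single p.1 p.2).sum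

theorem totalWeight_cons (p : ℕ × ℕ) (l : List (ℕ × ℕ)) :
    totalWeight (p :: l) = Pi.single p.1 p.2 + totalWeight l := by
  rw [totalWeight, List.map_cons, List.sum_cons, totalWeight]

theorem totalWeight_eq_zero {l : List (ℕ × ℕ)} {x : ℕ} (h : x ∉ l.map Prod.fst) :
    totalWeight l x = 0 := by
  induction l with
  | nil => rfl
  | cons p l ih =>
    rw [List.map_cons, List.mem_cons, not_or] at h
    rw [totalWeight_cons, Pi.add_apply, Pi.single_eq_of_ne h.1, ih h.2]

theorem totalWeight_le {l : List (ℕ × ℕ)} {c : ℕ} (h : ∀ p ∈ l, p.2 ≤ c) (x : ℕ) :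
    totalWeight l x ≤ l.length * c := by
  induction l with
  | nil => simp [totalWeight]
  | cons p l ih =>
    have hp : Pi.single (M := fun _ => ℕ) p.1 p.2 x ≤ c := by
      rw [Pi.single_apply]
      split_ifs
      exacts [h p List.mem_cons_self, Nat.zero_le c]
    rw [totalWeight_cons, Pi.add_apply, List.length_cons, Nat.succ_mul, add_comm]
    exact add_le_add (ih fun q hq => h q (List.mem_cons_of_mem p hq)) hp

/-- The set of points at which the `b`-th binary digit of the total weight is `1`. -/
def digitLayer (l : List (ℕ × ℕ)) (b : ℕ) : Finset ℕ :=
  (l.map Prod.fst).toFinset.filter fun x => (totalWeight l x).testBit b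

theorem mem_digitLayer {l : List (ℕ × ℕ)} {b x : ℕ} :
    x ∈ digitLayer l b ↔ (totalWeight l x).testBit b := by
  rw [digitLayer, Finset.mem_filter, List.mem_toFinset, and_iff_right_iff_imp]
  refine fun h => by_contra fun hx => ?_
  simp [totalWeight_eq_zero hx] at h

theorem card_digitLayer_le (l : List (ℕ × ℕ)) (b : ℕ) : (digitLayer l b).card ≤ l.length :=
  (Finset.card_filter_le _ _).trans ((List.toFinset_card_le _).trans (by simp))

theorem sum_digitLayer {B : ℕ} {l : List (ℕ × ℕ)} (hl : ∀ x, totalWeight l x < 2 ^ B) :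
    ∑ b ∈ Finset.range B, 2 ^ b • (fun x => if x ∈ digitLayer l b then 1 else 0) =
      totalWeight l := by
  funext x
  simpa [mem_digitLayer] using sum_range_two_pow_testBit (hl x)

end WeightedList

section AdjacencyForm

variable {V : Type*} [Fintype V] (G : SimpleGraph V) [DecidableRel G.Adj] (ident : V ↪ ℕ)

/-- The bilinear form on functions of identifiers that is given by the adjacency matrix. -/
noncomputable def adjacencyForm : (ℕ → ℕ) →ₗ[ℕ] (ℕ → ℕ) →ₗ[ℕ] ℕ :=
  LinearMap.mk₂ ℕ (fun f g => ∑ u, ∑ v ∈ G.neighborFinset u, f (ident u) * g (ident v))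
    (fun f f' g => by simp only [Pi.add_apply, add_mul, Finset.sum_add_distrib])
    (fun c f g => by simp only [Pi.smul_apply, smul_eq_mul, mul_assoc, Finset.mul_sum])
    (fun f g g' => by simp only [Pi.add_apply, mul_add, Finset.sum_add_distrib])
    (fun c f g => by simp only [Pi.smul_apply, smul_eq_mul, mul_left_comm _ c, Finset.mul_sum])

theorem adjacencyForm_apply (f g : ℕ → ℕ) :
    adjacencyForm G ident f g = ∑ u, ∑ v ∈ G.neighborFinset u, f (ident u) * g (ident v) := rfl

theorem adjacencyForm_comm (f g : ℕ → ℕ) :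
    adjacencyForm G ident f g = adjacencyForm G ident g f := by
  rw [adjacencyForm_apply, sum_neighborFinset_comm]
  simp only [mul_comm, adjacencyForm_apply]

/-- The entries of the adjacency matrix, indexed by identifiers. -/
noncomputable def adjacency (x y : ℕ) : ℕ := adjacencyForm G ident (Pi.single x 1) (Pi.single y 1)

theorem adjacency_comm (x y : ℕ) : adjacency G ident x y = adjacency G ident y x :=
  adjacencyForm_comm G ident _ _

theorem adjacency_ident (u v : V) :
    adjacency G ident (ident u) (ident v) = if G.Adj u v then 1 else 0 := by
  classical
  have hsingle (w w' : V) :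
      (Pi.single (ident w) 1 : ℕ → ℕ) (ident w') = if w' = w then 1 else 0 := by
    simp [Pi.single_apply]
  simp only [adjacency, adjacencyForm_apply, hsingle]
  rw [Finset.sum_eq_single u (by simp +contextual) (by simp)]
  simp

theorem adjacencyForm_totalWeight (l l' : List (ℕ × ℕ)) :
    adjacencyForm G ident (totalWeight l) (totalWeight l') =
      (l.map fun a => (l'.map fun b => a.2 * (b.2 * adjacency G ident a.1 b.1)).sum).sum := by
  have hsingle (p : ℕ × ℕ) : (Pi.single p.1 p.2 : ℕ → ℕ) = p.2 • Pi.single p.1 1 := by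
    rw [← Pi.single_smul, smul_eq_mul, mul_one]
  induction l with
  | nil => simp [totalWeight]
  | cons a l ih =>
    rw [totalWeight_cons, map_add, LinearMap.add_apply, ih, List.map_cons, List.sum_cons,
      hsingle, map_smul, LinearMap.smul_apply]
    simp only [totalWeight, hsingle, map_list_sum, List.map_map, Function.comp_def, map_smul,
      smul_eq_mul, adjacency, List.sum_map_mul_left]

variable [DecidableEq V]

/-- The number of edges both of whose endpoints have their identifiers in `S`. -/
def inducedEdges (S : Finset ℕ) : ℕ := (G.edgeFinset.filter fun e => ∀ v ∈ e, ident v ∈ S).card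

theorem two_mul_inducedEdges (S : Finset ℕ) :
    2 * inducedEdges G ident S = adjacencyForm G ident (fun x => if x ∈ S then 1 else 0)
      (fun x => if x ∈ S then 1 else 0) := by
  rw [inducedEdges, Finset.card_filter, ← smul_eq_mul,
    ← sum_neighborFinset_sym2 G fun e => if ∀ v ∈ e, ident v ∈ S then 1 else 0]
  refine Finset.sum_congr rfl fun u _ => Finset.sum_congr rfl fun v _ => ?_
  by_cases hu : ident u ∈ S <;> by_cases hv : ident v ∈ S <;> simp [hu, hv]

/-- Polarization of the quadratic form `inducedEdges`, with terms moved so that no subtraction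
occurs. -/
theorem inducedEdges_union_add_inter (A B : Finset ℕ) :
    inducedEdges G ident (A ∪ B) + inducedEdges G ident (A ∩ B) =
      adjacencyForm G ident (fun x => if x ∈ A then 1 else 0) (fun x => if x ∈ B then 1 else 0) +
        (inducedEdges G ident (A \ B) + inducedEdges G ident (B \ A)) := by
  have hquad := adjacencyForm_comm G ident (fun x => if x ∈ B then 1 else 0)
    (fun x => if x ∈ A then 1 else 0)
  suffices h : 2 * inducedEdges G ident (A ∪ B) + 2 * inducedEdges G ident (A ∩ B) =
      adjacencyForm G ident (fun x => if x ∈ A then 1 else 0) (fun x => if x ∈ B then 1 else 0) +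
      adjacencyForm G ident (fun x => if x ∈ B then 1 else 0) (fun x => if x ∈ A then 1 else 0) +
      2 * inducedEdges G ident (A \ B) + 2 * inducedEdges G ident (B \ A) by omega
  simp only [two_mul_inducedEdges, adjacencyForm_apply, ← Finset.sum_add_distrib]
  refine Finset.sum_congr rfl fun u _ => Finset.sum_congr rfl fun v _ => ?_
  by_cases huA : ident u ∈ A <;> by_cases hvA : ident v ∈ A <;> by_cases huB : ident u ∈ B <;>
    by_cases hvB : ident v ∈ B <;> simp [huA, hvA, huB, hvB]

end AdjacencyForm

section Graph

variable {V : Type*} [Fintype V] (G : SimpleGraph V) [DecidableRel G.Adj]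

/-- The number of neighbors of `u` of degree above `t`. -/
def heavyDegree (t : ℕ) (u : V) : ℕ := ((G.neighborFinset u).filter fun v => t < G.degree v).card

theorem heavyDegree_le (t : ℕ) (u : V) : heavyDegree G t u ≤ G.degree u :=
  Finset.card_filter_le _ _

theorem sum_heavyDegree (t : ℕ) :
    ∑ u with t < G.degree u, heavyDegree G t u = heavyPairs G t := by
  simp only [heavyPairs, heavyDegree, ite_and, Finset.sum_filter, Finset.card_filter]
  exact Finset.sum_congr rfl fun u _ => by split_ifs <;> simp

variable {G} in
theorem sum_adj_eq_heavyDegree {ident : V ↪ ℕ} {k : ℕ → ℕ → ℝ≥0∞}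
    (hk : ∀ u v, k (ident u) (ident v) = if G.Adj u v then 1 else 0) (t : ℕ) (u : V) :
    ∑ v with t < G.degree v, k (ident u) (ident v) = heavyDegree G t u := by
  simp only [hk, Finset.sum_boole, Finset.filter_filter, heavyDegree]
  congr 2
  ext v
  simp [and_comm]

end Graph

namespace Algorithm

section Replicate

variable {M : Access} {α β : Type} {V : Type*} [Fintype V] [DecidableEq V] (G : SimpleGraph V)
  [DecidableRel G.Adj] (ident : V ↪ ℕ)

theorem mean_list_sum (A : Algorithm M α) (k : β → α → ℝ≥0∞) (l : List β) :
    mean G ident A (fun a => (l.map fun b => k b a).sum) =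
      (l.map fun b => mean G ident A (k b)).sum := by
  induction l with
  | nil => exact mean_const G ident A 0
  | cons b l ih => simp only [List.map_cons, List.sum_cons, mean_add, ih]

theorem mean_replicate_sum_sum (A : Algorithm M α) (k : α → α → ℝ≥0∞) (r : ℕ) :
    (mean G ident (A.replicate r) fun l => mean G ident (A.replicate r) fun l' =>
      (l.map fun a => (l'.map (k a)).sum).sum) =
        r ^ 2 * mean G ident A fun a => mean G ident A (k a) := by
  simp only [mean_list_sum, mean_replicate_sum, mean_const_mul]
  ring

theorem mean_replicate_sum_sq_le (A : Algorithm M α) (φ : α → ℝ≥0∞) (r : ℕ) :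
    mean G ident (A.replicate r) (fun l => (l.map φ).sum ^ 2) ≤
      r * mean G ident A (fun a => φ a ^ 2) + r ^ 2 * mean G ident A φ ^ 2 :=
  le_self_add.trans_eq (mean_replicate_sum_sq G ident A φ r)

theorem mean_replicate_sum_sum_sq_le (A : Algorithm M α) {k : α → α → ℝ≥0∞}
    (hk : ∀ a b, k a b = k b a) (r : ℕ) :
    (mean G ident (A.replicate r) fun l => mean G ident (A.replicate r) fun l' =>
      (l.map fun a => (l'.map (k a)).sum).sum ^ 2) ≤
        r ^ 2 * (mean G ident A fun a => mean G ident A fun b => k a b ^ 2) +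
        2 * r ^ 3 * (mean G ident A fun a => mean G ident A (k a) ^ 2) +
        r ^ 4 * (mean G ident A fun a => mean G ident A (k a)) ^ 2 := by
  have hsymm (b : α) : (mean G ident A fun a => k a b) = mean G ident A (k b) := by
    simp only [hk _ b]
  have hinner (l' : List α) : mean G ident A (fun a => (l'.map (k a)).sum) =
      (l'.map fun b => mean G ident A (k b)).sum := by
    simp only [mean_list_sum G ident A (fun b a => k a b), hsymm]
  calc _ ≤ mean G ident (A.replicate r) fun l' =>
        r * mean G ident A (fun a => (l'.map (k a)).sum ^ 2) +
        r ^ 2 * (l'.map fun b => mean G ident A (k b)).sum ^ 2 := by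
        rw [mean_comm]
        exact mean_mono fun l' => hinner l' ▸ mean_replicate_sum_sq_le G ident A _ r
    _ = r * mean G ident A (fun a => mean G ident (A.replicate r) fun l' =>
          (l'.map (k a)).sum ^ 2) +
        r ^ 2 * mean G ident (A.replicate r) fun l' =>
          (l'.map fun b => mean G ident A (k b)).sum ^ 2 := by
        rw [mean_add, mean_const_mul, mean_const_mul, mean_comm]
    _ ≤ r * mean G ident A (fun a => r * mean G ident A (fun b => k a b ^ 2) +
          r ^ 2 * mean G ident A (k a) ^ 2) +
        r ^ 2 * (r * (mean G ident A fun a => mean G ident A (k a) ^ 2) +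
          r ^ 2 * (mean G ident A fun a => mean G ident A (k a)) ^ 2) := by
        gcongr
        · exact mean_mono fun a => mean_replicate_sum_sq_le G ident A _ r
        · exact mean_replicate_sum_sq_le G ident A _ r
    _ = _ := by
        rw [mean_add, mean_const_mul, mean_const_mul]
        ring

end Replicate

section HeavySampler

variable {M : Access} {V : Type*} [Fintype V] [DecidableEq V] (G : SimpleGraph V)
  [DecidableRel G.Adj] (ident : V ↪ ℕ)

/-- `W` returns an identifier and a number. If an output is counted with the weight that `w`
assigns to the number, then the vertices of degree above `t` are equally likely, the other ones do
not occur, and the weights are small on average. -/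
structure IsHeavySampler (t : ℕ) (W : Algorithm M (ℕ × ℕ)) (w : ℕ → ℝ≥0) : Prop where
  mean_eq (φ : ℕ → ℝ≥0∞) : mean G ident W (fun x => w x.2 * φ x.1) =
    (totalDegree G : ℝ≥0)⁻¹ * ∑ u with t < G.degree u, φ (ident u)
  mean_sq_le (φ : ℕ → ℝ≥0∞) : mean G ident W (fun x => (w x.2 : ℝ≥0∞) ^ 2 * φ x.1) ≤
    2 * (totalDegree G : ℝ≥0)⁻¹ *
      ∑ u with t < G.degree u, (G.degree u : ℝ≥0)⁻¹ * φ (ident u)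

variable {G ident} {t : ℕ} {W : Algorithm M (ℕ × ℕ)} {w : ℕ → ℝ≥0} {k : ℕ → ℕ → ℝ≥0∞}

theorem IsHeavySampler.mean_mean (hW : IsHeavySampler G ident t W w)
    (hk : ∀ u v, k (ident u) (ident v) = if G.Adj u v then 1 else 0) :
    (mean G ident W fun a => mean G ident W fun b => w a.2 * (w b.2 * k a.1 b.1)) =
      ((heavyPairs G t / totalDegree G ^ 2 : ℝ≥0) : ℝ≥0∞) := by
  simp only [mean_const_mul, hW.mean_eq (k _)]
  rw [hW.mean_eq fun x => ((totalDegree G : ℝ≥0)⁻¹ : ℝ≥0) *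
    ∑ v with t < G.degree v, k x (ident v)]
  simp only [sum_adj_eq_heavyDegree hk, ← Finset.mul_sum, ← Nat.cast_sum, sum_heavyDegree]
  norm_cast
  push_cast
  ring

theorem IsHeavySampler.mean_sq_mean_le (hW : IsHeavySampler G ident t W w)
    (hk : ∀ u v, k (ident u) (ident v) = if G.Adj u v then 1 else 0) :
    (mean G ident W fun a => (mean G ident W fun b => w a.2 * (w b.2 * k a.1 b.1)) ^ 2) ≤
      ((2 * heavyPairs G t / totalDegree G ^ 3 : ℝ≥0) : ℝ≥0∞) := by
  have hvertex (u : V) : (G.degree u : ℝ≥0)⁻¹ * (heavyDegree G t u ^ 2 : ℕ) ≤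
      heavyDegree G t u := by
    rw [← div_eq_inv_mul, sq, Nat.cast_mul]
    exact NNReal.div_le_of_le_mul (mul_le_mul_right (by exact_mod_cast heavyDegree_le G t u) _)
  simp only [mean_const_mul, hW.mean_eq (k _), mul_pow]
  refine (hW.mean_sq_le fun x => ((totalDegree G : ℝ≥0)⁻¹ : ℝ≥0) ^ 2 *
    (∑ v with t < G.degree v, k x (ident v)) ^ 2).trans ?_
  simp only [sum_adj_eq_heavyDegree hk]
  norm_cast
  calc _ ≤ 2 * (totalDegree G : ℝ≥0)⁻¹ * ∑ u with t < G.degree u,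
        ((totalDegree G : ℝ≥0)⁻¹ ^ 2 * heavyDegree G t u) := by
        refine mul_le_mul_right (Finset.sum_le_sum fun u _ => ?_) _
        rw [mul_left_comm]
        exact mul_le_mul_right (hvertex u) _
    _ = _ := by
        rw [← Finset.mul_sum, ← Nat.cast_sum, sum_heavyDegree]
        push_cast
        ring

theorem IsHeavySampler.mean_mean_sq_le (hW : IsHeavySampler G ident t W w)
    (hk : ∀ u v, k (ident u) (ident v) = if G.Adj u v then 1 else 0) :
    (mean G ident W fun a => mean G ident W fun b =>
      (w a.2 : ℝ≥0∞) ^ 2 * ((w b.2 : ℝ≥0∞) ^ 2 * k a.1 b.1)) ≤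
      ((4 * heavyPairs G t / (totalDegree G ^ 2 * (t + 1) ^ 2) : ℝ≥0) : ℝ≥0∞) := by
  have hheavy {φ : V → ℝ≥0∞} : ∑ u with t < G.degree u, (G.degree u : ℝ≥0)⁻¹ * φ u ≤
      ((t + 1 : ℝ≥0)⁻¹ : ℝ≥0) * ∑ u with t < G.degree u, φ u := by
    rw [Finset.mul_sum]
    gcongr with u hu
    exact_mod_cast (Finset.mem_filter.1 hu).2
  calc _ ≤ mean G ident W fun a => (w a.2 : ℝ≥0∞) ^ 2 * (2 * (totalDegree G : ℝ≥0)⁻¹ *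
        ((t + 1 : ℝ≥0)⁻¹ * ∑ v with t < G.degree v, k a.1 (ident v))) := by
        simp only [mean_const_mul]
        refine mean_mono fun a => ?_
        gcongr
        exact (hW.mean_sq_le (k a.1)).trans (by gcongr; exact hheavy)
    _ ≤ 2 * (totalDegree G : ℝ≥0)⁻¹ * ((t + 1 : ℝ≥0)⁻¹ * ∑ u with t < G.degree u,
        2 * (totalDegree G : ℝ≥0)⁻¹ * ((t + 1 : ℝ≥0)⁻¹ *
          ∑ v with t < G.degree v, k (ident u) (ident v))) :=
        (hW.mean_sq_le fun x => 2 * (totalDegree G : ℝ≥0)⁻¹ * ((t + 1 : ℝ≥0)⁻¹ *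
          ∑ v with t < G.degree v, k x (ident v))).trans (by gcongr; exact hheavy)
    _ = _ := by
        simp only [sum_adj_eq_heavyDegree hk, ← Finset.mul_sum, ← Nat.cast_sum,
          sum_heavyDegree]
        norm_cast
        push_cast
        rw [div_eq_mul_inv, mul_inv, ← inv_pow (t + 1 : ℝ≥0)]
        ring

end HeavySampler

section PairBatch

/-- The query for whether `x` and `y` are adjacent. -/
def adjacent (x y : ℕ) : Algorithm .pair Bool := query (.pair x y)

/-- The weight that makes the endpoints of degree `a > t` of random edges equally likely. -/
noncomputable def invAbove (t a : ℕ) : ℝ≥0 := if t < a then (a : ℝ≥0)⁻¹ else 0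

/-- The product of the weights of two random endpoints, replaced by zero if they are not
adjacent. -/
noncomputable def pairSample (t : ℕ) : Algorithm .pair ℝ≥0 := do
  let a ← endpointDegree
  let b ← endpointDegree
  let c ← adjacent a.1 b.1
  pure (invAbove t a.2 * (invAbove t b.2 * if c then 1 else 0))

theorem within_pairSample (t : ℕ) : (pairSample t).Within 5 fun _ => True :=
  within_endpointDegree.bind (c' := 3) fun _ _ =>
    within_endpointDegree.bind (c' := 1) fun _ _ =>
      (Within.query (.pair _ _)).bind (c' := 0) fun _ _ => .pure trivial

variable {V : Type*} [Fintype V] [DecidableEq V] {G : SimpleGraph V} [DecidableRel G.Adj]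
  {ident : V ↪ ℕ}

theorem mean_adjacent (u v : V) (φ : Bool → ℝ≥0∞) :
    mean G ident (adjacent (ident u) (ident v)) φ = φ (decide (G.Adj u v)) := by
  have hanswer : answer G ident (.pair (ident u) (ident v)) = PMF.pure (decide (G.Adj u v)) :=
    congrArg PMF.pure (decide_eq_decide.2 (by simp))
  exact (mean_query G ident (.pair (ident u) (ident v)) φ).trans (hanswer ▸ expect_pure _ _)

theorem isHeavySampler_endpointDegree {M : Access} (hG : 0 < totalDegree G) (t : ℕ) :
    IsHeavySampler G ident t (endpointDegree : Algorithm M (ℕ × ℕ)) (invAbove t) := by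
  have hD : (totalDegree G : ℝ≥0∞)⁻¹ = ((totalDegree G : ℝ≥0)⁻¹ : ℝ≥0) := by
    rw [ENNReal.coe_inv (by exact_mod_cast hG.ne'), ENNReal.coe_natCast]
  have hweight {v : V} (hv : t < G.degree v) :
      (G.degree v : ℝ≥0∞) * (invAbove t (G.degree v) : ℝ≥0∞) = 1 := by
    have hpos : (G.degree v : ℝ≥0) ≠ 0 := by exact_mod_cast (Nat.zero_lt_of_lt hv).ne'
    rw [invAbove, if_pos hv]
    exact_mod_cast mul_inv_cancel₀ hpos
  constructor
  · intro φ
    rw [mean_endpointDegree hG, hD, Finset.sum_filter]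
    refine congrArg _ (Finset.sum_congr rfl fun v _ => ?_)
    split_ifs with hv
    · rw [← mul_assoc, hweight hv, one_mul]
    · simp [invAbove, hv]
  · intro φ
    rw [mean_endpointDegree hG, hD, Finset.sum_filter, mul_assoc]
    refine le_trans (mul_le_mul_right (Finset.sum_le_sum fun v _ => ?_) _)
      (le_mul_of_one_le_left' one_le_two)
    split_ifs with hv
    · rw [sq, mul_assoc, ← mul_assoc, hweight hv, one_mul, invAbove, if_pos hv]
    · simp [invAbove, hv]

theorem isEstimator_pairSample (hG : 0 < totalDegree G) (t : ℕ) :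
    IsEstimator G ident (pairSample t) (heavyPairs G t / totalDegree G ^ 2)
      (4 * heavyPairs G t / (totalDegree G ^ 2 * (t + 1) ^ 2)) := by
  have hsampler := isHeavySampler_endpointDegree (M := .pair) (ident := ident) hG t
  let k (x y : ℕ) : ℝ≥0∞ := mean G ident (adjacent x y) fun c => if c then 1 else 0
  have hk (u v : V) : k (ident u) (ident v) = if G.Adj u v then 1 else 0 := by
    simp [k, mean_adjacent]
  have hcoe (c : Bool) : ((if c then 1 else 0 : ℝ≥0) : ℝ≥0∞) = if c then 1 else 0 := by
    split_ifs <;> rfl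
  constructor
  · rw [← hsampler.mean_mean hk]
    simp only [pairSample, mean_bind, mean_pure, ENNReal.coe_mul, mean_const_mul, hcoe, k]
  · refine le_trans (le_of_eq ?_) ((hsampler.mean_mean_sq_le hk).trans le_add_self)
    simp only [pairSample, mean_bind, mean_pure, ENNReal.coe_mul, mul_pow, mean_const_mul, hcoe,
      ite_pow, one_pow, zero_pow two_ne_zero, k]

end PairBatch

section AdditiveBatch

variable {M : Access}

/-- The query for the number of edges inside `S`. -/
def additive (S : Finset ℕ) : Algorithm .additive ℕ := query (.additive S)

/-- The sum of the outputs of the first `k` members of a family of algorithms. -/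
def sumRange (f : ℕ → Algorithm M ℕ) : ℕ → Algorithm M ℕ
  | 0 => pure 0
  | k + 1 => do
    let s ← sumRange f k
    let c ← f k
    pure (s + c)

/-- The number of adjacent pairs in `A × B`. -/
def crossPairs (A B : Finset ℕ) : Algorithm .additive ℕ := do
  let a ← additive (A ∪ B)
  let b ← additive (A ∩ B)
  let c ← additive (A \ B)
  let d ← additive (B \ A)
  pure (a + b - (c + d))

/-- The number of adjacent pairs in `l × l'`, counted with the product of the weights. It is
computed one pair of binary digits at a time, as every layer of digits is just a set; the weights
should have at most `B` digits. -/
def weightedPairs (B : ℕ) (l l' : List (ℕ × ℕ)) : Algorithm .additive ℕ :=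
  sumRange (fun b => sumRange (fun b' => do
    let c ← crossPairs (digitLayer l b) (digitLayer l' b')
    pure (2 ^ b * (2 ^ b' * c))) B) B

/-- A random endpoint of a random edge. Its weight is zero if its degree is at most `t`; otherwise
it is `n` divided by the degree, rounded at random to an integer with this mean. -/
noncomputable def weightedEndpoint (n t : ℕ) : Algorithm M (ℕ × ℕ) := do
  let x ← endpointDegree
  let i ← draw (uniformOr (Finset.range x.2) 0)
  pure (x.1, if t < x.2 then (n + i) / x.2 else 0)

/-- The average weight of the adjacent pairs between two samples of `r` weighted endpoints. -/
noncomputable def additiveBatch (n t r B : ℕ) : Algorithm .additive ℝ≥0 := do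
  let l ← (weightedEndpoint n t).replicate r
  let l' ← (weightedEndpoint n t).replicate r
  let c ← weightedPairs B l l'
  pure (c / (n * r : ℝ≥0) ^ 2)

theorem within_sumRange {f : ℕ → Algorithm M ℕ} {c : ℕ} (h : ∀ i, (f i).Within c fun _ => True)
    (k : ℕ) : (sumRange f k).Within (k * c) fun _ => True := by
  induction k with
  | zero => exact .pure trivial
  | succ k ih =>
    exact (ih.bind fun _ _ => (h k).bind (c' := 0) fun _ _ => .pure trivial).mono
      (by rw [add_zero, Nat.succ_mul]) fun _ => id

theorem within_crossPairs (A B : Finset ℕ) :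
    (crossPairs A B).Within (2 * (A.card + B.card)) fun _ => True := by
  refine Within.mono ((Within.query (.additive _)).bind fun _ _ =>
    (Within.query (.additive _)).bind fun _ _ => (Within.query (.additive _)).bind fun _ _ =>
      (Within.query (.additive _)).bind (c' := 0) fun _ _ => .pure trivial) ?_ fun _ => id
  have hunion := Finset.card_union_add_card_inter A B
  have hleft := Finset.card_le_card (Finset.sdiff_subset (s := A) (t := B))
  have hright := Finset.card_le_card (Finset.sdiff_subset (s := B) (t := A))
  simp only [Query.cost]
  omega

theorem within_weightedPairs (B : ℕ) {r : ℕ} {l l' : List (ℕ × ℕ)} (hl : l.length = r)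
    (hl' : l'.length = r) : (weightedPairs B l l').Within (B * (B * (4 * r))) fun _ => True := by
  refine within_sumRange (fun b => within_sumRange (fun b' => ?_) B) B
  refine ((within_crossPairs _ _).bind (c' := 0) fun _ _ => .pure trivial).mono ?_ fun _ => id
  have hcard := card_digitLayer_le l b
  have hcard' := card_digitLayer_le l' b'
  omega

theorem within_weightedEndpoint (n t : ℕ) :
    (weightedEndpoint n t : Algorithm M (ℕ × ℕ)).Within 2 (·.2 ≤ n + 1) := by
  refine within_endpointDegree.bind (c' := 0) fun x _ =>
    (Within.draw _).bind (c' := 0) fun i hi => .pure ?_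
  dsimp only
  split_ifs with hx
  · have hpos : 0 < x.2 := Nat.zero_lt_of_lt hx
    have hi : i < x.2 := by
      simpa [uniformOr, hpos.ne'] using hi
    calc (n + i) / x.2 ≤ (n + x.2) / x.2 := Nat.div_le_div_right (by omega)
      _ = n / x.2 + 1 := Nat.add_div_right n hpos
      _ ≤ n + 1 := by gcongr; exact Nat.div_le_self _ _
  · exact Nat.zero_le _

theorem within_additiveBatch (n t r B : ℕ) :
    (additiveBatch n t r B).Within (4 * r * (1 + B ^ 2)) fun _ => True :=
  (((within_weightedEndpoint n t).replicate r).bind fun _ hl =>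
    ((within_weightedEndpoint n t).replicate r).bind fun _ hl' =>
      (within_weightedPairs B hl.1 hl'.1).bind (c' := 0) fun _ _ => .pure trivial).mono
    (le_of_eq (by ring)) fun _ => id

variable {V : Type*} [Fintype V] [DecidableEq V] {G : SimpleGraph V} [DecidableRel G.Adj]
  {ident : V ↪ ℕ}

theorem mean_additive (S : Finset ℕ) (φ : ℕ → ℝ≥0∞) :
    mean G ident (additive S) φ = φ (inducedEdges G ident S) :=
  (mean_query G ident (.additive S) φ).trans (expect_pure _ _)

theorem mean_sumRange {f : ℕ → Algorithm M ℕ} {v : ℕ → ℕ}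
    (h : ∀ i φ, mean G ident (f i) φ = φ (v i)) (k : ℕ) (φ : ℕ → ℝ≥0∞) :
    mean G ident (sumRange f k) φ = φ (∑ i ∈ Finset.range k, v i) := by
  induction k generalizing φ with
  | zero => simp only [sumRange, mean_pure, Finset.range_zero, Finset.sum_empty]
  | succ k ih => simp only [sumRange, mean_bind, ih, h, mean_pure, Finset.sum_range_succ]

theorem mean_crossPairs (A B : Finset ℕ) (φ : ℕ → ℝ≥0∞) :
    mean G ident (crossPairs A B) φ = φ (adjacencyForm G ident
      (fun x => if x ∈ A then 1 else 0) (fun x => if x ∈ B then 1 else 0)) := by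
  simp only [crossPairs, mean_bind, mean_additive, mean_pure]
  rw [inducedEdges_union_add_inter, Nat.add_sub_cancel]

theorem mean_weightedPairs {B : ℕ} {l l' : List (ℕ × ℕ)} (hl : ∀ x, totalWeight l x < 2 ^ B)
    (hl' : ∀ x, totalWeight l' x < 2 ^ B) (φ : ℕ → ℝ≥0∞) :
    mean G ident (weightedPairs B l l') φ =
      φ (adjacencyForm G ident (totalWeight l) (totalWeight l')) := by
  rw [← sum_digitLayer hl, ← sum_digitLayer hl', map_sum (adjacencyForm G ident),
    LinearMap.sum_apply]
  simp only [map_sum, map_smul, LinearMap.smul_apply, smul_eq_mul]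
  refine mean_sumRange (fun b φ => mean_sumRange (fun b' φ => ?_) B φ) B φ
  rw [mean_bind, mean_crossPairs, mean_pure]
  congr 1
  ring

theorem mean_weightedEndpoint (hG : 0 < totalDegree G) (n t : ℕ) (φ : ℕ × ℕ → ℝ≥0∞) :
    mean G ident (weightedEndpoint n t : Algorithm M (ℕ × ℕ)) φ =
      ((totalDegree G : ℝ≥0)⁻¹ : ℝ≥0) * ∑ v, ∑ i ∈ Finset.range (G.degree v),
        φ (ident v, if t < G.degree v then (n + i) / G.degree v else 0) := by
  rw [ENNReal.coe_inv (by exact_mod_cast hG.ne'), ENNReal.coe_natCast]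
  simp only [weightedEndpoint, mean_bind, mean_pure, mean_draw, mean_endpointDegree hG]
  refine congrArg _ (Finset.sum_congr rfl fun v _ => ?_)
  rcases (G.degree v).eq_zero_or_pos with hv | hv
  · simp [hv]
  · rw [expect_uniformOr (by simpa using hv.ne'), Finset.card_range,
      ENNReal.mul_inv_cancel_left (by exact_mod_cast hv.ne') (by simp)]

theorem isHeavySampler_weightedEndpoint (hG : 0 < totalDegree G) (t : ℕ) :
    IsHeavySampler G ident t (weightedEndpoint (Fintype.card V) t : Algorithm M (ℕ × ℕ))
      fun k => (k / Fintype.card V : ℝ≥0) := by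
  set n := Fintype.card V
  have hn (v : V) : (n : ℝ≥0) ≠ 0 :=
    Nat.cast_ne_zero.2 (Nat.zero_lt_of_lt (G.degree_lt_card_verts v)).ne'
  constructor <;> intro φ <;>
    simp only [mean_weightedEndpoint hG, Finset.sum_filter, ← Finset.sum_mul]
  · refine congrArg _ (Finset.sum_congr rfl fun v _ => ?_)
    split_ifs with hv
    · have hsum : ∑ i ∈ Finset.range (G.degree v), (((n + i) / G.degree v : ℕ) / n : ℝ≥0) = 1 := by
        rw [← Finset.sum_div, ← Nat.cast_sum, sum_range_add_div n (Nat.zero_lt_of_lt hv),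
          div_self (hn v)]
      rw [← ENNReal.ofNNReal_finsetSum, hsum, ENNReal.coe_one, one_mul]
    · simp
  · rw [mul_comm 2, mul_assoc, Finset.mul_sum (a := (2 : ℝ≥0∞))]
    refine mul_le_mul_right (Finset.sum_le_sum fun v _ => ?_) _
    split_ifs with hv
    · have hpos := Nat.zero_lt_of_lt hv
      have hsum : ∑ i ∈ Finset.range (G.degree v),
          (((n + i) / G.degree v : ℕ) / n : ℝ≥0) ^ 2 ≤ 2 * (G.degree v : ℝ≥0)⁻¹ := by
        simp only [div_pow]
        rw [← Finset.sum_div, ← div_eq_mul_inv,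
          div_le_div_iff₀ (pow_pos (hn v).bot_lt 2) (by exact_mod_cast hpos)]
        exact_mod_cast sum_range_add_div_sq_le hpos (G.degree_lt_card_verts v).le
      rw [← mul_assoc]
      gcongr
      exact_mod_cast hsum
    · simp

theorem mean_additiveBatch {n r B : ℕ} (hn : n ≠ 0) (hB : r * (n + 1) < 2 ^ B) (t : ℕ)
    (φ : ℝ≥0∞ → ℝ≥0∞) :
    mean G ident (additiveBatch n t r B) (fun x => φ x) =
      mean G ident ((weightedEndpoint n t : Algorithm .additive _).replicate r) fun l =>
        mean G ident ((weightedEndpoint n t : Algorithm .additive _).replicate r) fun l' =>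
          φ ((((r : ℝ≥0)⁻¹ ^ 2 : ℝ≥0) : ℝ≥0∞) * (l.map fun a => (l'.map fun b =>
            ((a.2 / n : ℝ≥0) : ℝ≥0∞) * (((b.2 / n : ℝ≥0) : ℝ≥0∞) *
              adjacency G ident a.1 b.1)).sum).sum) := by
  have hdigits {l : List (ℕ × ℕ)} (hl : l.length = r ∧ ∀ p ∈ l, p.2 ≤ n + 1) (x : ℕ) :
      totalWeight l x < 2 ^ B := (totalWeight_le hl.2 x).trans_lt (hl.1 ▸ hB)
  have hscale (l l' : List (ℕ × ℕ)) :
      (adjacencyForm G ident (totalWeight l) (totalWeight l') : ℝ≥0) = (n : ℝ≥0) ^ 2 *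
        (l.map fun a => (l'.map fun b =>
          (a.2 / n : ℝ≥0) * ((b.2 / n : ℝ≥0) * adjacency G ident a.1 b.1)).sum).sum := by
    simp only [adjacencyForm_totalWeight, ← List.sum_map_mul_left, Nat.cast_list_sum,
      List.map_map, Function.comp_def, Nat.cast_mul]
    field_simp
  simp only [additiveBatch, mean_bind]
  refine ((within_weightedEndpoint n t).replicate r).mean_congr fun l hl =>
    ((within_weightedEndpoint n t).replicate r).mean_congr fun l' hl' => ?_
  rw [mean_weightedPairs (hdigits hl) (hdigits hl'), mean_pure, hscale]
  congr 1
  have hring (x : ℝ≥0) : n ^ 2 * x / (n * r) ^ 2 = (r : ℝ≥0)⁻¹ ^ 2 * x := by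
    field_simp
  rw [hring, ENNReal.coe_mul]
  congr 1
  simp only [coe_list_sum, List.map_map, Function.comp_def, ENNReal.coe_mul, ENNReal.coe_natCast]

theorem isEstimator_additiveBatch (hG : 0 < totalDegree G) (t : ℕ) {r B : ℕ} (hr : r ≠ 0)
    (hB : r * (Fintype.card V + 1) < 2 ^ B) :
    IsEstimator G ident (additiveBatch (Fintype.card V) t r B)
      (heavyPairs G t / totalDegree G ^ 2)
      (4 * heavyPairs G t / (totalDegree G ^ 2 * (t + 1) ^ 2) / r ^ 2 +
        4 * heavyPairs G t / totalDegree G ^ 3 / r) := by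
  let W : Algorithm .additive (ℕ × ℕ) := weightedEndpoint (Fintype.card V) t
  let w (k : ℕ) : ℝ≥0 := k / Fintype.card V
  let k (a b : ℕ × ℕ) : ℝ≥0∞ := w a.2 * (w b.2 * adjacency G ident a.1 b.1)
  have hsampler : IsHeavySampler G ident t W w := isHeavySampler_weightedEndpoint hG t
  have hadj (u v : V) : (adjacency G ident (ident u) (ident v) : ℝ≥0∞) =
      if G.Adj u v then 1 else 0 := by
    rw [adjacency_ident, Nat.cast_ite, Nat.cast_one, Nat.cast_zero]
  have hsymm (a b : ℕ × ℕ) : k a b = k b a := by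
    simp only [k, adjacency_comm G ident a.1, mul_left_comm]
  have hn : Fintype.card V ≠ 0 := fun hn => by
    simpa [hn, hG.ne'] using totalDegree_le_card_sq G
  have hmean := hsampler.mean_mean (k := fun x y => adjacency G ident x y) hadj
  have hmarginal := hsampler.mean_sq_mean_le (k := fun x y => adjacency G ident x y) hadj
  have hsquare : (mean G ident W fun a => mean G ident W fun b => k a b ^ 2) ≤
      ((4 * heavyPairs G t / (totalDegree G ^ 2 * (t + 1) ^ 2) : ℝ≥0) : ℝ≥0∞) := by
    simp only [k, mul_pow]
    exact hsampler.mean_mean_sq_le (k := fun x y => adjacency G ident x y ^ 2) fun u v => by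
      rw [hadj, ite_pow, one_pow, zero_pow two_ne_zero]
  have hr' : (r : ℝ≥0) ≠ 0 := Nat.cast_ne_zero.2 hr
  constructor
  · refine (mean_additiveBatch hn hB t id).trans ?_
    simp only [id, mean_const_mul]
    rw [mean_replicate_sum_sum G ident W k, hmean]
    norm_cast
    push_cast
    field_simp
  · refine (mean_additiveBatch hn hB t (· ^ 2)).trans_le ?_
    simp only [mul_pow, mean_const_mul]
    refine (mul_le_mul_right (mean_replicate_sum_sum_sq_le G ident W hsymm r) _).trans ?_
    rw [hmean]
    refine (mul_le_mul_right (add_le_add_left (add_le_add (mul_le_mul_right hsquare _)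
      (mul_le_mul_right hmarginal _)) _) _).trans_eq ?_
    norm_cast
    push_cast
    field_simp
    ring

end AdditiveBatch

section Search

variable {M : Access} {V : Type*} [Fintype V] [DecidableEq V] {G : SimpleGraph V}
  [DecidableRel G.Adj] {ident : V ↪ ℕ}

/-- Run at most `fuel` of the estimators `est i`, `est (i + 1)`, …, where `est j` relies on the
guess `g j`, until an output is at least a quarter of the guess. -/
noncomputable def search (est : ℕ → Algorithm M ℝ) (g : ℕ → ℝ) : ℕ → ℕ → Algorithm M ℝ
  | 0, _ => pure 0
  | fuel + 1, i => do
      let x ← est i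
      if g i ≤ 4 * x then pure x else search est g fuel (i + 1)

theorem succeeds_search {est : ℕ → Algorithm M ℝ} {g : ℕ → ℝ} {c I : ℕ} {d ε : ℝ} {δ : ℝ≥0}
    (hε : 0 < ε) (hε1 : ε < 1) (hgI : g I ≤ 2 * d)
    (hest : ∀ i ≤ I, Succeeds G ident (est i) c (fun x => |x - d| ≤ ε / 20 * g i) δ)
    {i fuel : ℕ} (hi : i ≤ I) (hfuel : I < i + fuel) :
    Succeeds G ident (search est g fuel i) (fuel * c) (fun x => |x - d| ≤ ε * d) (fuel * δ) := by
  induction fuel generalizing i with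
  | zero => omega
  | succ fuel ih =>
    refine ((hest i hi).bind (c' := fuel * c) (δ' := fuel * δ) fun x hx => ?_).mono
      (by rw [add_one_mul, add_comm]) (fun _ => id) (by push_cast; rw [add_one_mul, add_comm])
    have hg : 0 ≤ g i := by nlinarith [(abs_nonneg _).trans hx]
    have hclose := abs_le.1 (hx.trans (by nlinarith : ε / 20 * g i ≤ g i / 20))
    by_cases haccept : g i ≤ 4 * x
    · rw [if_pos haccept]
      have hgood : |x - d| ≤ ε * d := hx.trans (by nlinarith)
      exact (Within.pure (P := fun x => |x - d| ≤ ε * d) hgood).succeeds.mono (Nat.zero_le _)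
        (fun _ => id) zero_le
    · rw [if_neg haccept]
      have hne : i ≠ I := by
        rintro rfl
        exact haccept (by linarith)
      exact ih (by omega) (by omega)

end Search

end Algorithm

section Combine

/-- The estimate of the average degree obtained from the estimates `h` of the fraction of heavy
edges, `y` of the contribution of the other edges to the average degree, and `z` of the fraction of
heavy edges divided by the sum of the degrees. -/
noncomputable def combine (n h y z : ℝ) : ℝ := if h < 1 / 2 then y / (1 - h) else h / (n * z)

variable {n d g h h' y z μ e : ℝ}

theorem abs_div_one_sub_sub_le (hd : 0 ≤ d) (hdg : d ≤ g) (hh' : |h' - h| ≤ e)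
    (hy : |y - d * (1 - h)| ≤ e * g) (hlt : h' < 1 / 2) : |y / (1 - h') - d| ≤ 4 * e * g := by
  have hpos : 0 < 1 - h' := by linarith
  have herror : y / (1 - h') - d = (y - d * (1 - h) + d * (h' - h)) / (1 - h') := by
    field_simp
    ring
  have he : 0 ≤ e := (abs_nonneg _).trans hh'
  rw [herror, abs_div, abs_of_pos hpos, div_le_iff₀ hpos]
  calc |y - d * (1 - h) + d * (h' - h)| ≤ |y - d * (1 - h)| + |d * (h' - h)| := abs_add_le _ _
    _ ≤ e * g + g * e := by
      rw [abs_mul, abs_of_nonneg hd]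
      gcongr
      exact hd.trans hdg
    _ ≤ 4 * e * g * (1 - h') := by nlinarith [mul_nonneg he (hd.trans hdg)]

theorem abs_div_mul_sub_le (hn : 0 < n) (hd : 0 < d) (he : e ≤ 1 / 100) (hh : h ≤ 1)
    (hμ : μ * (n * d) = h) (hh' : |h' - h| ≤ e) (hz : |z - μ| ≤ e * μ) (hge : 1 / 2 ≤ h') :
    |h' / (n * z) - d| ≤ 5 * e * d := by
  have hclose := abs_le.1 hh'
  have he0 : 0 ≤ e := (abs_nonneg _).trans hh'
  have hnd : 0 < n * d := by positivity
  set w := z * (n * d) with hw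
  have hwh : |w - h| ≤ e * h := by
    rw [hw, ← hμ, ← sub_mul, abs_mul, abs_of_pos hnd, ← mul_assoc e]
    exact mul_le_mul_of_nonneg_right hz hnd.le
  have hwpos : 48 / 100 ≤ w := by nlinarith [abs_le.1 hwh]
  have hz0 : z ≠ 0 := fun hz0 => by norm_num [hw, hz0] at hwpos
  have herror : h' / (n * z) - d = d * (h' - w) / w := by
    rw [hw]
    field_simp
  have hhw : |h' - w| ≤ 2 * e :=
    calc |h' - w| ≤ |h' - h| + |h - w| := abs_sub_le _ _ _
      _ ≤ e + e * h := add_le_add hh' (abs_sub_comm h w ▸ hwh)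
      _ ≤ 2 * e := by nlinarith
  rw [herror, abs_div, abs_mul, abs_of_pos hd, abs_of_pos (by linarith : 0 < w),
    div_le_iff₀ (by linarith)]
  calc d * |h' - w| ≤ d * (2 * e) := by gcongr
    _ ≤ 5 * e * d * w := by nlinarith [mul_nonneg he0 hd.le]

theorem abs_combine_sub_le (hn : 0 < n) (hd : 0 < d) (hdg : d ≤ g) (he : e ≤ 1 / 100)
    (hh : h ≤ 1) (hμ : μ * (n * d) = h) (hh' : |h' - h| ≤ e) (hy : |y - d * (1 - h)| ≤ e * g)
    (hz : 2 / 5 ≤ h → |z - μ| ≤ e * μ) : |combine n h' y z - d| ≤ 5 * e * g := by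
  have he0 : 0 ≤ e := (abs_nonneg _).trans hh'
  unfold combine
  split_ifs with hlt
  · exact (abs_div_one_sub_sub_le hd.le hdg hh' hy hlt).trans
      (by nlinarith [mul_nonneg he0 (hd.le.trans hdg)])
  · have hlarge : 2 / 5 ≤ h := by linarith [abs_le.1 hh']
    exact (abs_div_mul_sub_le hn hd he hh hμ hh' (hz hlarge) (not_lt.1 hlt)).trans (by gcongr)

end Combine

section Parameters

/-- One more than the integral part of the binary logarithm. -/
def logSize (n : ℕ) : ℕ := Nat.log 2 n + 1

/-- The least power of two whose `p`-th power is at least `2 ^ i`: the batch size of the estimator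
with exponent `1 / p` when the guess of the average degree is `n / 2 ^ i`. -/
def radius (p i : ℕ) : ℕ := 2 ^ ((i + p - 1) / p)

/-- The degree above which a vertex counts as heavy when the guess of the average degree is
`n / 2 ^ i`. -/
def threshold (n p i : ℕ) : ℕ := n * radius p i / 2 ^ i

theorem one_le_radius (p i : ℕ) : 1 ≤ radius p i := Nat.one_le_two_pow

theorem radius_ne_zero (p i : ℕ) : radius p i ≠ 0 := Nat.one_le_iff_ne_zero.1 (one_le_radius p i)

theorem radius_mono (p : ℕ) : Monotone (radius p) := fun _ _ h =>
  Nat.pow_le_pow_right two_pos (Nat.div_le_div_right (by omega))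

theorem radius_le_two_pow {p : ℕ} (hp : 0 < p) (i : ℕ) : radius p i ≤ 2 ^ i := by
  refine Nat.pow_le_pow_right two_pos (Nat.lt_succ_iff.1 ?_)
  rw [Nat.div_lt_iff_lt_mul hp]
  nlinarith [Nat.sub_lt (Nat.add_pos_right i hp) one_pos]

theorem two_pow_le_radius_pow {p : ℕ} (hp : 0 < p) (i : ℕ) : 2 ^ i ≤ radius p i ^ p := by
  rw [radius, ← pow_mul]
  refine Nat.pow_le_pow_right two_pos ?_
  have := Nat.lt_div_mul_add hp (a := i + p - 1)
  omega

theorem cast_radius_le {p : ℕ} (hp : 0 < p) (i : ℕ) :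
    (radius p i : ℝ) ≤ 2 * ((2 : ℝ) ^ i) ^ (1 / (p : ℝ)) := by
  have hexponent : (((i + p - 1) / p : ℕ) : ℝ) ≤ i * (1 / (p : ℝ)) + 1 :=
    calc (((i + p - 1) / p : ℕ) : ℝ) ≤ ((i + p - 1 : ℕ) : ℝ) / p := Nat.cast_div_le
      _ ≤ (i + p) / p := by
        gcongr
        exact_mod_cast Nat.sub_le _ _
      _ = i * (1 / (p : ℝ)) + 1 := by field_simp
  calc (radius p i : ℝ) = (2 : ℝ) ^ (((i + p - 1) / p : ℕ) : ℝ) := by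
        rw [radius, Real.rpow_natCast, Nat.cast_pow, Nat.cast_two]
    _ ≤ 2 ^ (i * (1 / (p : ℝ)) + 1) := Real.rpow_le_rpow_of_exponent_le one_le_two hexponent
    _ = 2 * ((2 : ℝ) ^ i) ^ (1 / (p : ℝ)) := by
        rw [Real.rpow_add two_pos, Real.rpow_one, mul_comm, Real.rpow_mul zero_le_two,
          Real.rpow_natCast]

theorem threshold_le (n p i : ℕ) : (threshold n p i : ℝ≥0) ≤ n / 2 ^ i * radius p i := by
  refine Nat.cast_div_le.trans_eq ?_
  push_cast
  ring

theorem le_threshold_sq {n p D i : ℕ} (hD : D * 2 ^ i ≤ n ^ 2) :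
    D ≤ (threshold n (p + 2) i + 1) ^ 2 * radius (p + 2) i ^ p := by
  set r := radius (p + 2) i
  set t := threshold n (p + 2) i with ht
  have hthreshold : n * r ≤ (t + 1) * 2 ^ i := by
    rw [add_one_mul, ht]
    exact (Nat.lt_div_mul_add (a := n * r) (b := 2 ^ i) (by positivity)).le
  have hradius : 2 ^ i ≤ r ^ (p + 2) := two_pow_le_radius_pow (by omega) i
  refine Nat.le_of_mul_le_mul_right (c := 2 ^ i * 2 ^ i) ?_ (by positivity)
  calc D * (2 ^ i * 2 ^ i) = D * 2 ^ i * 2 ^ i := by ring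
    _ ≤ n ^ 2 * r ^ (p + 2) := Nat.mul_le_mul hD hradius
    _ = (n * r) ^ 2 * r ^ p := by ring
    _ ≤ ((t + 1) * 2 ^ i) ^ 2 * r ^ p := by gcongr
    _ = (t + 1) ^ 2 * r ^ p * (2 ^ i * 2 ^ i) := by ring

theorem one_le_logSize (n : ℕ) : 1 ≤ logSize n := Nat.le_add_left _ _

theorem one_le_logSize_sq (n : ℕ) : 1 ≤ logSize n ^ 2 := Nat.one_le_pow _ _ (one_le_logSize n)

theorem lt_two_pow_logSize (n : ℕ) : n < 2 ^ logSize n :=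
  Nat.lt_pow_succ_log_self one_lt_two n

theorem logSize_le {n : ℕ} (hn : 2 ≤ n) : (logSize n : ℝ) ≤ 3 * Real.log n := by
  have hlog_two : Real.log 2 ≤ Real.log n := Real.log_le_log two_pos (by exact_mod_cast hn)
  have hlog : (Nat.log 2 n : ℝ) * Real.log 2 ≤ Real.log n := by
    rw [← Real.log_pow]
    refine Real.log_le_log (by positivity) ?_
    exact_mod_cast Nat.pow_log_le_self 2 (by omega)
  rw [logSize]
  push_cast
  nlinarith [Real.log_two_gt_d9, Nat.cast_nonneg (α := ℝ) (Nat.log 2 n)]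

theorem radius_mul_lt {n p i : ℕ} (hp : 0 < p) (hi : 2 ^ i ≤ n) :
    radius p i * (n + 1) < 2 ^ (2 * logSize n) := by
  have hn := lt_two_pow_logSize n
  calc radius p i * (n + 1) ≤ n * 2 ^ logSize n :=
        Nat.mul_le_mul ((radius_le_two_pow hp i).trans hi) hn
    _ < 2 ^ logSize n * 2 ^ logSize n := Nat.mul_lt_mul_of_pos_right hn (by positivity)
    _ = 2 ^ (2 * logSize n) := by rw [two_mul, pow_add]

theorem exists_lt_logSize_mul_two_pow_le {n D : ℕ} (hn : 0 < n) (hnD : n ≤ D) (hDn : D ≤ n ^ 2) :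
    ∃ I < logSize n, D * 2 ^ I ≤ n ^ 2 ∧ n ^ 2 < D * 2 ^ (I + 1) := by
  have hD : 0 < D := hn.trans_le hnD
  refine ⟨Nat.log 2 (n ^ 2 / D), Nat.lt_succ_of_le (Nat.log_mono_right ?_), ?_, ?_⟩
  · exact Nat.div_le_of_le_mul (by nlinarith)
  · rw [mul_comm]
    exact (Nat.le_div_iff_mul_le hD).1 (Nat.pow_log_le_self 2 (Nat.div_pos hDn hD).ne')
  · rw [mul_comm]
    exact (Nat.div_lt_iff_lt_mul hD).1 (Nat.lt_pow_succ_log_self one_lt_two _)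

end Parameters

section Heavy

variable {M : Access} {V : Type*} [Fintype V] [DecidableEq V] (G : SimpleGraph V)
  [DecidableRel G.Adj] (ident : V ↪ ℕ)

/-- `heavy n i` costs `Õ(radius p i)` queries. If the average degree is at most the guess
`n / 2 ^ i`, then it estimates, up to the factor `1 / totalDegree G`, the fraction of edges between
vertices of degree above `threshold n p i`. -/
structure IsHeavyEstimator (p κ : ℕ) (heavy : ℕ → ℕ → Algorithm M ℝ≥0) : Prop where
  within : ∀ n i, (heavy n i).Within (κ * radius p i * logSize n ^ 2) fun _ => True
  isEstimator : ∀ i, totalDegree G * 2 ^ i ≤ Fintype.card V ^ 2 →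
    Algorithm.IsEstimator G ident (heavy (Fintype.card V) i)
      (heavyPairs G (threshold (Fintype.card V) p i) / totalDegree G ^ 2)
      (8 * heavyPairs G (threshold (Fintype.card V) p i) / totalDegree G ^ 3)

/-- The heavy estimator that uses pair queries. -/
noncomputable def heavyPairEstimator (n i : ℕ) : Algorithm .pair ℝ≥0 :=
  (Algorithm.pairSample (threshold n 3 i)).average (radius 3 i)

/-- The heavy estimator that uses additive queries. -/
noncomputable def heavyAdditiveEstimator (n i : ℕ) : Algorithm .additive ℝ≥0 :=
  Algorithm.additiveBatch n (threshold n 4 i) (radius 4 i) (2 * logSize n)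

variable {G ident}

theorem div_threshold_sq_le {H D t s : ℝ≥0} (hD : 0 < D) (hDt : D ≤ (t + 1) ^ 2 * s) :
    4 * H / (D ^ 2 * (t + 1) ^ 2) / s ≤ 4 * H / D ^ 3 := by
  rw [div_div, pow_succ D 2, mul_assoc]
  gcongr

theorem isHeavyEstimator_heavyPairEstimator (hG : 0 < totalDegree G) :
    IsHeavyEstimator G ident 3 5 heavyPairEstimator where
  within n i := by
    refine ((Algorithm.within_pairSample _).average _).mono ?_ fun _ => id
    rw [mul_comm]
    exact Nat.le_mul_of_pos_right _ (one_le_logSize_sq n)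
  isEstimator i hi := by
    refine ((Algorithm.isEstimator_pairSample hG _).average (radius_ne_zero 3 i)).mono ?_
    have hD : (totalDegree G : ℝ≥0) ≤
        (threshold (Fintype.card V) 3 i + 1) ^ 2 * radius 3 i := by
      exact_mod_cast pow_one (radius 3 i) ▸ le_threshold_sq (p := 1) hi
    refine (div_threshold_sq_le (by exact_mod_cast hG) hD).trans ?_
    gcongr
    norm_num

theorem isHeavyEstimator_heavyAdditiveEstimator (hG : 0 < totalDegree G)
    (hn : Fintype.card V ≤ totalDegree G) :
    IsHeavyEstimator G ident 4 20 heavyAdditiveEstimator where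
  within n i := by
    refine (Algorithm.within_additiveBatch _ _ _ _).mono ?_ fun _ => id
    calc 4 * radius 4 i * (1 + (2 * logSize n) ^ 2)
        ≤ 4 * radius 4 i * (logSize n ^ 2 + (2 * logSize n) ^ 2) := by
          gcongr
          exact one_le_logSize_sq n
      _ = 20 * radius 4 i * logSize n ^ 2 := by ring
  isEstimator i hi := by
    have hguess : 2 ^ i ≤ Fintype.card V := by
      nlinarith [Nat.mul_le_mul_right (2 ^ i) hn]
    refine (Algorithm.isEstimator_additiveBatch hG _ (radius_ne_zero 4 i)
      (radius_mul_lt (by norm_num) hguess)).mono ?_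
    have hD : (totalDegree G : ℝ≥0) ≤
        (threshold (Fintype.card V) 4 i + 1) ^ 2 * radius 4 i ^ 2 := by
      exact_mod_cast le_threshold_sq (p := 2) hi
    have hr : (1 : ℝ≥0) ≤ radius 4 i := by exact_mod_cast one_le_radius 4 i
    calc _ ≤ 4 * (heavyPairs G (threshold (Fintype.card V) 4 i) : ℝ≥0) / totalDegree G ^ 3 +
          4 * (heavyPairs G (threshold (Fintype.card V) 4 i) : ℝ≥0) / totalDegree G ^ 3 :=
        add_le_add (div_threshold_sq_le (by exact_mod_cast hG) hD)
          (div_le_self zero_le hr)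
      _ = _ := by ring

end Heavy

section Estimate

variable {M : Access}

/-- The estimate of the average degree from `T` batches of samples, for the guess `n / 2 ^ i`. -/
noncomputable def estimate (heavy : ℕ → ℕ → Algorithm M ℝ≥0) (p T n i : ℕ) : Algorithm M ℝ := do
  let h ← (Algorithm.heavyEdge (threshold n p i)).average T
  let y ← (Algorithm.lightDegree (threshold n p i)).average (T * radius p i)
  let z ← (heavy n i).average T
  pure (combine n h y z)

variable {V : Type*} [Fintype V] [DecidableEq V] {G : SimpleGraph V} [DecidableRel G.Adj]
  {ident : V ↪ ℕ} {T : ℕ} {e : ℝ≥0}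

theorem succeeds_average_heavyEdge (hG : 0 < totalDegree G) (hT : T ≠ 0) (he : e ≠ 0) (t : ℕ) :
    Algorithm.Succeeds G ident ((Algorithm.heavyEdge t : Algorithm M ℝ≥0).average T) (T * 3)
      (fun x => |(x : ℝ) - (heavyPairs G t / totalDegree G : ℝ≥0)| ≤ e) (1 / T / e ^ 2) := by
  refine (((Algorithm.isEstimator_heavyEdge hG t).average hT).succeeds
    ((Algorithm.within_heavyEdge t).average T) he).mono le_rfl (fun _ => id) ?_
  gcongr
  exact div_le_one_of_le₀ (by exact_mod_cast heavyPairs_le_totalDegree G t) zero_le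

theorem succeeds_average_lightDegree [Nonempty V] (hdeg : ∀ v, 1 ≤ G.degree v) (hT : T ≠ 0)
    (he : e ≠ 0) {t r : ℕ} {g : ℝ≥0} (hr : r ≠ 0) (hg : g ≠ 0) (ht : (t : ℝ≥0) ≤ g * r)
    (hlight : (lightPairs G t / Fintype.card V : ℝ≥0) ≤ g) :
    Algorithm.Succeeds G ident ((Algorithm.lightDegree t : Algorithm M ℝ≥0).average (T * r))
      (T * r * 4) (fun x => |(x : ℝ) - (lightPairs G t / Fintype.card V : ℝ≥0)| ≤ (e * g : ℝ≥0))
      (2 / T / e ^ 2) := by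
  refine (((Algorithm.isEstimator_lightDegree hdeg t).average (mul_ne_zero hT hr)).succeeds
    ((Algorithm.within_lightDegree t).average _) (mul_ne_zero he hg)).mono le_rfl
      (fun _ => id) ?_
  calc _ ≤ 2 * (g * r) * g / (T * r : ℕ) / (e * g) ^ 2 := by gcongr
    _ = 2 / T / e ^ 2 := by
      push_cast
      field_simp

theorem succeeds_average_heavy {A : Algorithm M ℝ≥0} {c : ℕ} {H D : ℝ≥0}
    (hA : A.Within c fun _ => True)
    (h : Algorithm.IsEstimator G ident A (H / D ^ 2) (8 * H / D ^ 3)) (hT : T ≠ 0) (he : e ≠ 0)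
    (hD : 0 < D) :
    Algorithm.Succeeds G ident (A.average T) (T * c) (fun x => 2 / 5 ≤ H / D →
      |(x : ℝ) - (H / D ^ 2 : ℝ≥0)| ≤ (e * (H / D ^ 2) : ℝ≥0)) (20 / T / e ^ 2) := by
  by_cases hH : 2 / 5 ≤ H / D
  · have hDH : D ≤ 5 / 2 * H := by
      rw [le_div_iff₀ hD] at hH
      calc D = 5 / 2 * (2 / 5 * D) := by field_simp
        _ ≤ 5 / 2 * H := by gcongr
    have hH0 : H ≠ 0 := by
      rintro rfl
      simp [hD.ne'] at hDH
    refine ((h.average hT).succeeds (hA.average T)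
      (mul_ne_zero he (by positivity))).mono le_rfl (fun _ hx _ => hx) ?_
    calc _ = 8 * D / H / T / e ^ 2 := by field_simp
      _ ≤ 8 * (5 / 2 * H) / H / T / e ^ 2 := by gcongr
      _ = 20 / T / e ^ 2 := by
        field_simp
        norm_num
  · exact (hA.average T).succeeds.mono le_rfl (fun _ _ hH' => absurd hH' hH) zero_le

theorem estimate_cost_le (κ p T n i : ℕ) :
    T * 3 + (T * radius p i * 4 + (T * (κ * radius p i * logSize n ^ 2) + 0)) ≤
      T * radius p i * logSize n ^ 2 * (7 + κ) := by
  have hr : 1 ≤ radius p i := one_le_radius p i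
  have hL : 1 ≤ logSize n ^ 2 := one_le_logSize_sq n
  calc _ = T * 1 * 1 * 3 + T * radius p i * 1 * 4 + T * radius p i * logSize n ^ 2 * κ := by ring
    _ ≤ T * radius p i * logSize n ^ 2 * 3 + T * radius p i * logSize n ^ 2 * 4 +
        T * radius p i * logSize n ^ 2 * κ := by gcongr
    _ = T * radius p i * logSize n ^ 2 * (7 + κ) := by ring

theorem succeeds_estimate [Nonempty V] {heavy : ℕ → ℕ → Algorithm M ℝ≥0} {p κ : ℕ}
    (h : IsHeavyEstimator G ident p κ heavy) (hdeg : ∀ v, 1 ≤ G.degree v) (hT : T ≠ 0)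
    (he : e ≠ 0) (he1 : e ≤ 1 / 100) {i : ℕ}
    (hi : totalDegree G * 2 ^ i ≤ Fintype.card V ^ 2) :
    Algorithm.Succeeds G ident (estimate heavy p T (Fintype.card V) i)
      (T * radius p i * logSize (Fintype.card V) ^ 2 * (7 + κ))
      (fun x => |x - totalDegree G / Fintype.card V| ≤ 5 * e * (Fintype.card V / 2 ^ i))
      (23 / T / e ^ 2) := by
  have hn : 0 < Fintype.card V := Fintype.card_pos
  have hD : 0 < totalDegree G := hn.trans_le (card_le_totalDegree hdeg)
  set n := Fintype.card V
  set D := totalDegree G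
  set t := threshold n p i
  set H := heavyPairs G t
  set L := lightPairs G t
  have hLH : L + H = D := lightPairs_add_heavyPairs G t
  have hdg : (D / n : ℝ≥0) ≤ n / 2 ^ i := by
    rw [div_le_div_iff₀ (by exact_mod_cast hn) (by positivity), ← sq]
    exact_mod_cast hi
  have hlight : (L / n : ℝ≥0) ≤ n / 2 ^ i :=
    le_trans (by gcongr; exact Nat.le.intro hLH) hdg
  refine ((succeeds_average_heavyEdge hD hT he t).bind fun h' hh' =>
    (succeeds_average_lightDegree hdeg hT he (radius_ne_zero p i) (g := n / 2 ^ i)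
      (by positivity) (threshold_le n p i) hlight).bind fun y hy =>
      (succeeds_average_heavy (h.within n i) (h.isEstimator i hi) hT he
        (by exact_mod_cast hD)).bind (c' := 0)
        (Q := fun x => |x - (D : ℝ) / n| ≤ 5 * e * (n / 2 ^ i)) fun z hz =>
        (Algorithm.Within.pure ?_).succeeds).mono (estimate_cost_le κ p T n i) (fun _ => id)
          (le_of_eq (by ring))
  have hn0 : (0 : ℝ) < n := by exact_mod_cast hn
  have hD0 : (0 : ℝ) < D := by exact_mod_cast hD
  have hHD : (H : ℝ) ≤ D := by exact_mod_cast heavyPairs_le_totalDegree G t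
  have hlight_eq : (L : ℝ) / n = D / n * (1 - H / D) := by
    field_simp
    rw [eq_sub_iff_add_eq]
    exact_mod_cast hLH
  refine abs_combine_sub_le (h := H / D) (μ := H / D ^ 2) hn0 (by positivity)
    (by exact_mod_cast hdg) (by exact_mod_cast he1) ((div_le_one hD0).2 hHD) (by field_simp)
    (by simpa using hh') ?_ fun hlarge => ?_
  · rw [← hlight_eq]
    simpa using hy
  · simpa using hz (by rw [← NNReal.coe_le_coe]; simpa using hlarge)

end Estimate

section EstimateAverageDegree

/-- The number of repetitions that brings the failure probability below `1 / 100`. -/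
noncomputable def repetitions (n : ℕ) (ε : ℝ) : ℕ := ⌈50000000 * logSize n / ε ^ 2⌉₊

/-- The search for the average degree through the guesses `n / 2 ^ i`. -/
noncomputable def estimateAverageDegree {M : Access} (heavy : ℕ → ℕ → Algorithm M ℝ≥0) (p n : ℕ)
    (ε : ℝ) : Algorithm M ℝ :=
  Algorithm.search (estimate heavy p (repetitions n ε) n) (fun i => n / 2 ^ i) (logSize n) 0

theorem le_repetitions (n : ℕ) (ε : ℝ) : 50000000 * logSize n / ε ^ 2 ≤ (repetitions n ε : ℝ) :=
  Nat.le_ceil _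

theorem repetitions_pos (n : ℕ) {ε : ℝ} (hε : 0 < ε) : 0 < repetitions n ε := by
  have hL : (0 : ℝ) < logSize n := by exact_mod_cast one_le_logSize n
  exact Nat.ceil_pos.2 (by positivity)

theorem repetitions_le (n : ℕ) {ε : ℝ} (hε : 0 < ε) (hε1 : ε < 1) :
    (repetitions n ε : ℝ) ≤ 50000001 * logSize n / ε ^ 2 := by
  have hL : (1 : ℝ) ≤ logSize n := by exact_mod_cast one_le_logSize n
  have hone : 1 ≤ logSize n / ε ^ 2 := by
    rw [one_le_div (by positivity)]
    nlinarith
  calc (repetitions n ε : ℝ) ≤ 50000000 * logSize n / ε ^ 2 + 1 :=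
        (Nat.ceil_lt_add_one (by positivity)).le
    _ ≤ 50000000 * logSize n / ε ^ 2 + logSize n / ε ^ 2 := by gcongr
    _ = 50000001 * logSize n / ε ^ 2 := by ring

theorem logSize_mul_failure_add_lt_one (n : ℕ) {ε : ℝ≥0} (hε : 0 < ε) :
    (logSize n : ℝ≥0) * (23 / repetitions n ε / (ε / 100) ^ 2) + 99 / 100 < 1 := by
  have hT : (0 : ℝ) < repetitions n ε := by exact_mod_cast repetitions_pos n hε
  have hlarge := le_repetitions n ε
  have hε' : (0 : ℝ) < ε := hε
  rw [div_le_iff₀ (by positivity)] at hlarge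
  have hfailure : (logSize n : ℝ) * (23 / repetitions n ε / (ε / 100) ^ 2) ≤ 1 / 200 := by
    rw [div_div, mul_div_assoc', div_le_div_iff₀ (by positivity) (by norm_num)]
    nlinarith
  rw [← NNReal.coe_lt_coe]
  push_cast
  linarith

theorem cost_le {n p κ I : ℕ} {ε x : ℝ} (hn : 2 ≤ n) (hp : 0 < p) (hε : 0 < ε) (hε1 : ε < 1)
    (hx : 2 ^ I ≤ x) :
    ((logSize n * (repetitions n ε * radius p I * logSize n ^ 2 * (7 + κ)) : ℕ) : ℝ) ≤
      10 ^ 10 * (7 + κ) * (1 / ε ^ 2) * Real.log n ^ 4 * x ^ (1 / (p : ℝ)) := by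
  have hrepetitions := repetitions_le n hε hε1
  have hlog := logSize_le hn
  have hx0 : 0 ≤ x := (by positivity : (0 : ℝ) ≤ 2 ^ I).trans hx
  have hradius : (radius p I : ℝ) ≤ 2 * x ^ (1 / (p : ℝ)) :=
    (cast_radius_le hp I).trans (by gcongr)
  push_cast
  calc (logSize n : ℝ) * (repetitions n ε * radius p I * logSize n ^ 2 * (7 + κ))
      ≤ logSize n * (50000001 * logSize n / ε ^ 2 * (2 * x ^ (1 / (p : ℝ))) * logSize n ^ 2 *
        (7 + κ)) := by gcongr
    _ = 100000002 * (7 + κ) * (1 / ε ^ 2) * (logSize n : ℝ) ^ 4 * x ^ (1 / (p : ℝ)) := by ring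
    _ ≤ 100000002 * (7 + κ) * (1 / ε ^ 2) * (3 * Real.log n) ^ 4 * x ^ (1 / (p : ℝ)) := by gcongr
    _ = 100000002 * 3 ^ 4 * ((7 + κ) * (1 / ε ^ 2) * Real.log n ^ 4 * x ^ (1 / (p : ℝ))) := by ring
    _ ≤ 10 ^ 10 * ((7 + κ) * (1 / ε ^ 2) * Real.log n ^ 4 * x ^ (1 / (p : ℝ))) := by
      gcongr
      norm_num
    _ = _ := by ring

variable {M : Access} {V : Type*} [Fintype V] [DecidableEq V] [Nonempty V] {G : SimpleGraph V}
  [DecidableRel G.Adj] {ident : V ↪ ℕ} {heavy : ℕ → ℕ → Algorithm M ℝ≥0} {p κ : ℕ}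

theorem succeeds_estimateAverageDegree (h : IsHeavyEstimator G ident p κ heavy)
    (hdeg : ∀ v, 1 ≤ G.degree v) {ε : ℝ≥0} (hε : 0 < ε) (hε1 : ε < 1) {I : ℕ}
    (hI : I < logSize (Fintype.card V)) (hle : totalDegree G * 2 ^ I ≤ Fintype.card V ^ 2)
    (hlt : Fintype.card V ^ 2 < totalDegree G * 2 ^ (I + 1)) :
    Algorithm.Succeeds G ident (estimateAverageDegree heavy p (Fintype.card V) ε)
      (logSize (Fintype.card V) * (repetitions (Fintype.card V) ε * radius p I *
        logSize (Fintype.card V) ^ 2 * (7 + κ)))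
      (fun x => |x - avgDegree G| ≤ ε * avgDegree G)
      (logSize (Fintype.card V) *
        (23 / repetitions (Fintype.card V) ε / (ε / 100) ^ 2)) := by
  have hguess : (Fintype.card V : ℝ) / 2 ^ I ≤ 2 * avgDegree G := by
    have hsq : (Fintype.card V : ℝ) ^ 2 ≤ totalDegree G * 2 ^ (I + 1) := by exact_mod_cast hlt.le
    rw [avgDegree_eq_totalDegree_div, ← mul_div_assoc,
      div_le_div_iff₀ (by positivity) (by positivity), ← sq]
    exact hsq.trans_eq (by ring)
  refine Algorithm.succeeds_search (g := fun i => (Fintype.card V : ℝ) / 2 ^ i)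
    (NNReal.coe_pos.2 hε) (by exact_mod_cast hε1) hguess (fun i hi => ?_) (Nat.zero_le I)
    (by rwa [zero_add])
  have hε0 : ε / 100 ≠ 0 := by positivity
  refine (succeeds_estimate h hdeg (repetitions_pos _ hε).ne' hε0 (by gcongr)
    ((Nat.mul_le_mul_left _ (Nat.pow_le_pow_right two_pos hi)).trans hle)).mono ?_ ?_ le_rfl
  · have hradius := radius_mono p hi
    gcongr ?_ * _ * _
    exact Nat.mul_le_mul_left _ hradius
  · intro x hx
    rw [avgDegree_eq_totalDegree_div]
    refine hx.trans_eq ?_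
    push_cast
    ring

theorem lt_toOuterMeasure_estimateAverageDegree (h : IsHeavyEstimator G ident p κ heavy)
    (hp : 0 < p) (hdeg : ∀ v, 1 ≤ G.degree v) {ε : ℝ} (hε : 0 < ε) (hε1 : ε < 1) :
    (99 / 100 : ℝ≥0∞) <
      (run G ident (estimateAverageDegree heavy p (Fintype.card V) ε)).toOuterMeasure
        {o : ℝ × ℕ | |o.1 - avgDegree G| ≤ ε * avgDegree G ∧
          (o.2 : ℝ) ≤ 10 ^ 10 * (7 + κ) * (1 / ε ^ 2) * Real.log (Fintype.card V) ^ 4 *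
            ((Fintype.card V : ℝ) / avgDegree G) ^ (1 / (p : ℝ))} := by
  lift ε to ℝ≥0 using hε.le
  have hn : 2 ≤ Fintype.card V := by
    have v := Classical.arbitrary V
    exact (Nat.succ_le_succ (hdeg v)).trans (G.degree_lt_card_verts v)
  have hnD : Fintype.card V ≤ totalDegree G := card_le_totalDegree hdeg
  have hD : (0 : ℝ) < totalDegree G := by exact_mod_cast Fintype.card_pos.trans_le hnD
  obtain ⟨I, hI, hle, hlt⟩ := exists_lt_logSize_mul_two_pow_le Fintype.card_pos hnD
    (totalDegree_le_card_sq G)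
  have hratio : (2 : ℝ) ^ I ≤ Fintype.card V / avgDegree G := by
    rw [avgDegree_eq_totalDegree_div, div_div_eq_mul_div, ← sq, le_div_iff₀ hD, mul_comm]
    exact_mod_cast hle
  have hsucceeds := (succeeds_estimateAverageDegree h hdeg (by exact_mod_cast hε)
    (by exact_mod_cast hε1) hI hle hlt).lt_toOuterMeasure
      (logSize_mul_failure_add_lt_one _ (by exact_mod_cast hε))
  refine (lt_of_eq_of_lt ?_ hsucceeds).trans_le (PMF.toOuterMeasure_mono _ fun o ho => ?_)
  · rw [ENNReal.coe_div (by norm_num)]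
    norm_num
  · exact ⟨ho.1.1, (Nat.cast_le.2 ho.1.2).trans (cost_le hn hp hε hε1 hratio)⟩

end EstimateAverageDegree

end SublinearGraph

theorem lemma3p8 :
    (∃ (estimateAverageDegree : ℕ → ℝ → SublinearGraph.Algorithm SublinearGraph.Access.pair ℝ)
        (C : ℝ) (k : ℕ),
      ∀ (ε : ℝ), 0 < ε → ε < 1 →
      ∀ (V : Type*) [Fintype V] [DecidableEq V] [Nonempty V]
        (G : SimpleGraph V) [DecidableRel G.Adj] (ident : V ↪ ℕ),
        (∀ v : V, 1 ≤ G.degree v) →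
        (99 / 100 : ℝ≥0∞) <
          (SublinearGraph.run G ident
            (estimateAverageDegree (Fintype.card V) ε)).toOuterMeasure
            {o : ℝ × ℕ |
              |o.1 - SublinearGraph.avgDegree G| ≤ ε * SublinearGraph.avgDegree G ∧
              (o.2 : ℝ) ≤ C * (1 / ε ^ 2) * Real.log (Fintype.card V) ^ k *
                ((Fintype.card V : ℝ) / SublinearGraph.avgDegree G) ^ (1 / 3 : ℝ)}) ∧
    (∃ (estimateAverageDegree : ℕ → ℝ → SublinearGraph.Algorithm SublinearGraph.Access.additive ℝ)
        (C : ℝ) (k : ℕ),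
      ∀ (ε : ℝ), 0 < ε → ε < 1 →
      ∀ (V : Type*) [Fintype V] [DecidableEq V] [Nonempty V]
        (G : SimpleGraph V) [DecidableRel G.Adj] (ident : V ↪ ℕ),
        (∀ v : V, 1 ≤ G.degree v) →
        (99 / 100 : ℝ≥0∞) <
          (SublinearGraph.run G ident
            (estimateAverageDegree (Fintype.card V) ε)).toOuterMeasure
            {o : ℝ × ℕ |
              |o.1 - SublinearGraph.avgDegree G| ≤ ε * SublinearGraph.avgDegree G ∧
              (o.2 : ℝ) ≤ C * (1 / ε ^ 2) * Real.log (Fintype.card V) ^ k *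
                ((Fintype.card V : ℝ) / SublinearGraph.avgDegree G) ^ (1 / 4 : ℝ)}) := by
  refine ⟨⟨SublinearGraph.estimateAverageDegree SublinearGraph.heavyPairEstimator 3,
      10 ^ 10 * (7 + (5 : ℕ)), 4, fun ε hε hε1 V _ _ _ G _ ident hdeg => ?_⟩,
    ⟨SublinearGraph.estimateAverageDegree SublinearGraph.heavyAdditiveEstimator 4,
      10 ^ 10 * (7 + (20 : ℕ)), 4, fun ε hε hε1 V _ _ _ G _ ident hdeg => ?_⟩⟩
  all_goals
    have hn := SublinearGraph.card_le_totalDegree hdeg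
    have hG := Fintype.card_pos.trans_le hn
  · exact SublinearGraph.lt_toOuterMeasure_estimateAverageDegree (p := 3)
      (SublinearGraph.isHeavyEstimator_heavyPairEstimator hG) (by norm_num) hdeg hε hε1
  · exact SublinearGraph.lt_toOuterMeasure_estimateAverageDegree (p := 4)
      (SublinearGraph.isHeavyEstimator_heavyAdditiveEstimator hG hn) (by norm_num) hdeg hε hε1
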